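/- Let $(M^m,g)$ and $(N^n,h)$ be smooth Riemannian manifolds without boundary and let $\phi:(M^m,g)\to(N^n,h)$ be an isometric immersion, i.e. a smooth map with $\phi^*h=g$ (a submanifold $M^m\hookrightarrow (N^n,h)$ with its induced metric). Let $\tau(\phi)=\mathrm{Trace}_g\nabla d\phi$ be the tension field, and let $\eta=\frac1m\mathrm{Trace}_g B$ be the mean curvature vector field, where $B(X,Y)=(\nabla^N_X d\phi(Y))^{\perp}$ is the second fundamental form ($\eta=0$ if $m=0$). The submanifold is minimal if $\eta\equiv0$. For a smooth function $f:M\to(0,\infty)$ the submanifold is $f$-biharmonic if $\phi$ is a critical point of the $f$-bienergy $$E_{2,f}(\phi)=\frac12\int_\Omega f\,|\tau(\phi)|^2\,v_g ,$$ i.e. if $\frac{d}{dt}\big|_{t=0}\frac12\int_K f\,|\tau(\phi_t)|^2v_g=0$ for every compact $K\subset M$ and every smooth variation $(\phi_t)_{t\in\mathbb R}$, $\phi_t:M\to N$, of $\phi_0=\phi$ with $\phi_t=\phi$ outside $K$. The $f$-biharmonic map equation is $$\tau_{2,f}(\phi)=f\,\tau_2(\phi)+(\Delta f)\,\tau(\phi)+2\nabla^{\phi}_{\mathrm{grad}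 f}\,\tau(\phi)=0,$$ $$\tau_2(\phi)=\mathrm{Trace}_g(\nabla^\phi\nabla^\phi-\nabla^\phi_{\nabla^M})\tau(\phi)-\mathrm{Trace}_g R^N(d\phi,\tau(\phi))d\phi ,$$ where $R^N(X,Y)Z=[\nabla^N_X,\nabla^N_Y]Z-\nabla^N_{[X,Y]}Z$. Then the submanifold is minimal if and only if it is $f$-biharmonic for every smooth positive function $f:M\to(0,\infty)$. Likewise, it is minimal if and only if $\tau_{2,f}(\phi)\equiv0$ for every smooth positive function $f:M\to(0,\infty)$. -/

import Mathlib

open scoped Manifold ContDiff Bundle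
open Bundle Set MeasureTheory

noncomputable section

namespace FBiharm

/-! ### Covariant differentiation along a map

Throughout, a Riemannian manifold `(N, h)` of dimension `n` is a smooth manifold modelled on
`EuclideanSpace ℝ (Fin n)` whose tangent bundle carries a smooth Riemannian bundle structure.
For a tangent vector `u` at `y`, the vector field `FiberBundle.extend _ u` is the field defined near
`y` which has constant components in the preferred chart at `y` and takes the value `u` at `y`. -/

section Connection

variable {n : ℕ} {N : Type*} [TopologicalSpace N] [ChartedSpace (EuclideanSpace ℝ (Fin n)) N]

instance instFiniteDimensionalTangentSpace (y : N) :
    FiniteDimensional ℝ (TangentSpace (𝓡 n) y) :=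
  inferInstanceAs (FiniteDimensional ℝ (EuclideanSpace ℝ (Fin n)))

theorem finrank_tangentSpace (y : N) : Module.finrank ℝ (TangentSpace (𝓡 n) y) = n :=
  finrank_euclideanSpace_fin (𝕜 := ℝ) (n := n)

variable [IsManifold (𝓡 n) ∞ N] [RiemannianBundle (fun y : N ↦ TangentSpace (𝓡 n) y)]

/-- The local vector field with constant components in the preferred chart at `y`
and with value `u` at `y`. -/
def constField {y : N} (u : TangentSpace (𝓡 n) y) : Π z : N, TangentSpace (𝓡 n) z :=
  FiberBundle.extend (EuclideanSpace ℝ (Fin n)) u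

variable (n) in
/-- An orthonormal basis of the tangent space at `y`. -/
def onb (y : N) : OrthonormalBasis (Fin n) ℝ (TangentSpace (𝓡 n) y) :=
  (stdOrthonormalBasis ℝ (TangentSpace (𝓡 n) y)).reindex
    (finCongr (finrank_tangentSpace y))

/-- The derivative at `y`, in the direction `u`, of the function `⟨V, W⟩`. -/
def derivInner {y : N} (V W : Π z : N, TangentSpace (𝓡 n) z) (u : TangentSpace (𝓡 n) y) : ℝ :=
  mvfderiv (𝓡 n) (fun z : N ↦ inner ℝ (V z) (W z)) y u

/-- The Christoffel term `Γ(u, w)` of the Levi-Civita connection at `y` in the preferred chart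
at `y`. It is the covariant derivative at `y`, in the direction `u`, of the constant-component field
through `w`; since constant-component fields commute, the Koszul formula for it reads
`2 ⟨Γ(u, w), e⟩ = u ⟨W, E⟩ + w ⟨U, E⟩ - e ⟨U, W⟩`. -/
def christoffel (y : N) (u w : TangentSpace (𝓡 n) y) : TangentSpace (𝓡 n) y :=
  ∑ a, ((1 / 2 : ℝ) * (derivInner (constField w) (constField (onb n y a)) u
      + derivInner (constField u) (constField (onb n y a)) w
      - derivInner (constField u) (constField w) (onb n y a))) • onb n y a

variable {m : ℕ} {M : Type*} [TopologicalSpace M] [ChartedSpace (EuclideanSpace ℝ (Fin m)) M]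

/-- The components of a vector field `W` along `φ`, near `x`, in the preferred chart at `φ x`. -/
def localRep (φ : M → N) (W : Π x : M, TangentSpace (𝓡 n) (φ x)) (x x' : M) :
    EuclideanSpace ℝ (Fin n) :=
  (trivializationAt (EuclideanSpace ℝ (Fin n)) (TangentSpace (𝓡 n) : N → Type _) (φ x)
    ⟨φ x', W x'⟩).2

/-- `covAlong φ W x v` is `∇^φ_v W` at `x`: the covariant derivative of the vector field `W` along
`φ` in the direction `v ∈ T_x M`, for the pull-back of the Levi-Civita connection of `N`. In the
chart at `φ x` its components are `v(W^a) + Γ^a_{bc} dφ^b(v) W^c`. -/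
def covAlong (φ : M → N) (W : Π x : M, TangentSpace (𝓡 n) (φ x)) (x : M)
    (v : TangentSpace (𝓡 m) x) : TangentSpace (𝓡 n) (φ x) :=
  (trivializationAt (EuclideanSpace ℝ (Fin n)) (TangentSpace (𝓡 n) : N → Type _) (φ x)).symm (φ x)
      (mvfderiv (𝓡 m) (localRep φ W x) x v)
    + christoffel (φ x) (mfderiv (𝓡 m) (𝓡 n) φ x v) (W x)

/-- `nabla Y y u` is `∇_u Y` at `y`, for the Levi-Civita connection of `N`. -/
def nabla (Y : Π y : N, TangentSpace (𝓡 n) y) (y : N) (u : TangentSpace (𝓡 n) y) :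
    TangentSpace (𝓡 n) y :=
  covAlong (id : N → N) Y y u

/-- The curvature `R(u, v) w = [∇_U, ∇_V] W - ∇_{[U, V]} W` at `y`, where `U, V, W` are any local
extensions of `u, v, w`. -/
def curvature (y : N) (u v w : TangentSpace (𝓡 n) y) : TangentSpace (𝓡 n) y :=
  nabla (fun z ↦ nabla (constField w) z (constField v z)) y u
    - nabla (fun z ↦ nabla (constField w) z (constField u z)) y v
    - nabla (constField w) y (VectorField.mlieBracket (𝓡 n) (constField u) (constField v) y)

end Connection

section Maps

variable (m n : ℕ)
  {M : Type*} [TopologicalSpace M] [ChartedSpace (EuclideanSpace ℝ (Fin m)) M]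
  [IsManifold (𝓡 m) ∞ M] [RiemannianBundle (fun x : M ↦ TangentSpace (𝓡 m) x)]
  {N : Type*} [TopologicalSpace N] [ChartedSpace (EuclideanSpace ℝ (Fin n)) N]
  [IsManifold (𝓡 n) ∞ N] [RiemannianBundle (fun y : N ↦ TangentSpace (𝓡 n) y)]

/-- The vector field `dφ(X)` along `φ`. -/
def pushField (φ : M → N) (X : Π x : M, TangentSpace (𝓡 m) x) (x : M) : TangentSpace (𝓡 n) (φ x) :=
  mfderiv (𝓡 m) (𝓡 n) φ x (X x)

/-- The tension field `τ(φ) = Trace_g ∇dφ`. -/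
def tension (φ : M → N) (x : M) : TangentSpace (𝓡 n) (φ x) :=
  ∑ i, (covAlong φ (pushField m n φ (constField (onb m x i))) x (onb m x i)
    - mfderiv (𝓡 m) (𝓡 n) φ x (nabla (constField (onb m x i)) x (onb m x i)))

/-! ### Minimal submanifolds -/

/-- An isometric immersion: a smooth map with `φ^* h = g`. -/
structure IsIsometricImmersion (φ : M → N) : Prop where
  smooth : ContMDiff (𝓡 m) (𝓡 n) ∞ φ
  isometric : ∀ (x : M) (u v : TangentSpace (𝓡 m) x),
    inner ℝ (mfderiv (𝓡 m) (𝓡 n) φ x u) (mfderiv (𝓡 m) (𝓡 n) φ x v) = inner ℝ u v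

/-- The normal space at `x`: the orthogonal complement of `dφ(T_x M)` in `T_{φ x} N`. -/
def normalSpace (φ : M → N) (x : M) : Submodule ℝ (TangentSpace (𝓡 n) (φ x)) :=
  (LinearMap.range (mfderiv (𝓡 m) (𝓡 n) φ x).toLinearMap)ᗮ

/-- The second fundamental form `B(u, v) = (∇^N_U dφ(V))^⊥` of an immersion. -/
def secondFundamentalForm (φ : M → N) (x : M) (u v : TangentSpace (𝓡 m) x) :
    TangentSpace (𝓡 n) (φ x) :=
  (normalSpace m n φ x).starProjection (covAlong φ (pushField m n φ (constField v)) x u)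

/-- The mean curvature vector field `η = (1/m) Trace_g B`. -/
def meanCurvature (φ : M → N) (x : M) : TangentSpace (𝓡 n) (φ x) :=
  (m : ℝ)⁻¹ • ∑ i, secondFundamentalForm m n φ x (onb m x i) (onb m x i)

/-- A submanifold is minimal if its mean curvature vector field vanishes identically. -/
def IsMinimal (φ : M → N) : Prop := ∀ x, meanCurvature m n φ x = 0

/-! ### `f`-biharmonic maps as critical points of the `f`-bienergy -/

section Volume

variable [MeasurableSpace M]

/-- The Riemannian measure of the domain of the preferred chart at `x₀`, which in the coordinates of
that chart is `√(det (g_ij))` times Lebesgue measure. -/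
def chartVolume (x₀ : M) : Measure M :=
  ((volume.restrict (chartAt (EuclideanSpace ℝ (Fin m)) x₀).target).map
    (chartAt (EuclideanSpace ℝ (Fin m)) x₀).symm).withDensity fun y ↦
      ENNReal.ofReal (Real.sqrt (Matrix.of fun i j : Fin m ↦
        (inner ℝ (constField (y := x₀) (EuclideanSpace.single i (1 : ℝ)) y)
          (constField (y := x₀) (EuclideanSpace.single j (1 : ℝ)) y) : ℝ)).det)

variable (M) in
/-- The sequence `(c k, S k)` consists of compact sets `S k`, each inside the domain of the preferred
chart at `c k`, whose interiors cover `M`. -/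
def IsCompactChartCover (p : ℕ → M × Set M) : Prop :=
  (∀ k, IsCompact (p k).2 ∧ (p k).2 ⊆ (chartAt (EuclideanSpace ℝ (Fin m)) (p k).1).source) ∧
    ⋃ k, interior (p k).2 = univ

open Classical in
variable (M) in
/-- The Riemannian volume measure `v_g`: the members of a sequence of compact sets which cover `M`,
each inside a chart domain, are made disjoint, and the Riemannian measures of the pieces are added
up. (By the change of variables formula the choice of the sequence is irrelevant. On a second
countable manifold there is such a sequence unless `M` is empty.) -/
def riemannianVolume : Measure M :=
  if h : ∃ p : ℕ → M × Set M, IsCompactChartCover m M p then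
    Measure.sum fun k ↦
      (chartVolume m (h.choose k).1).restrict (disjointed (fun j ↦ (h.choose j).2) k)
  else 0

/-- The `f`-bienergy `E_{2,f}(φ) = (1/2) ∫_K f |τ(φ)|² v_g` of `φ` over `K`. -/
def fBienergy (f : M → ℝ) (K : Set M) (φ : M → N) : ℝ :=
  (1 / 2) * ∫ x in K, f x * ‖tension m n φ x‖ ^ 2 ∂(riemannianVolume m M)

/-- A smooth variation `(Φ_t)` of `φ` supported in `K`. -/
structure IsVariation (φ : M → N) (K : Set M) (Φ : ℝ → M → N) : Prop where
  smooth : ContMDiff (𝓘(ℝ, ℝ).prod (𝓡 m)) (𝓡 n) ∞ (fun p : ℝ × M ↦ Φ p.1 p.2)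
  zero : Φ 0 = φ
  eq_off : ∀ t, ∀ x ∉ K, Φ t x = φ x

/-- `φ` is `f`-biharmonic if it is a critical point of the `f`-bienergy over compact sets: the first
derivative of the `f`-bienergy vanishes for every smooth compactly supported variation. -/
def IsFBiharmonic (φ : M → N) (f : M → ℝ) : Prop :=
  ∀ (K : Set M) (Φ : ℝ → M → N), IsCompact K → IsVariation m n φ K Φ →
    HasDerivAt (fun t ↦ fBienergy m n f K (Φ t)) 0 0

end Volume

/-! ### The `f`-biharmonic map equation -/

/-- The Laplacian `Δf = Trace_g ∇df` of a function on `M`. -/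
def laplacian (f : M → ℝ) (x : M) : ℝ :=
  ∑ i, (mvfderiv (𝓡 m) (fun z : M ↦ mvfderiv (𝓡 m) f z (constField (onb m x i) z)) x (onb m x i)
    - mvfderiv (𝓡 m) f x (nabla (constField (onb m x i)) x (onb m x i)))

/-- The gradient of a function on `M`. -/
def grad (f : M → ℝ) (x : M) : TangentSpace (𝓡 m) x :=
  ∑ i, mvfderiv (𝓡 m) f x (onb m x i) • onb m x i

/-- The rough Laplacian `Trace_g (∇^φ ∇^φ - ∇^φ_{∇^M}) V` of a vector field `V` along `φ`. -/
def roughLaplacian (φ : M → N) (V : Π x : M, TangentSpace (𝓡 n) (φ x)) (x : M) :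
    TangentSpace (𝓡 n) (φ x) :=
  ∑ i, (covAlong φ (fun z ↦ covAlong φ V z (constField (onb m x i) z)) x (onb m x i)
    - covAlong φ V x (nabla (constField (onb m x i)) x (onb m x i)))

/-- The bitension field
`τ₂(φ) = Trace_g (∇^φ ∇^φ - ∇^φ_{∇^M}) τ(φ) - Trace_g R^N(dφ, τ(φ)) dφ`. -/
def bitension (φ : M → N) (x : M) : TangentSpace (𝓡 n) (φ x) :=
  roughLaplacian m n φ (tension m n φ) x
    - ∑ i, curvature (φ x) (mfderiv (𝓡 m) (𝓡 n) φ x (onb m x i)) (tension m n φ x)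
        (mfderiv (𝓡 m) (𝓡 n) φ x (onb m x i))

/-- The `f`-bitension field `τ_{2,f}(φ) = f τ₂(φ) + (Δf) τ(φ) + 2 ∇^φ_{grad f} τ(φ)`. -/
def fBitension (φ : M → N) (f : M → ℝ) (x : M) : TangentSpace (𝓡 n) (φ x) :=
  f x • bitension m n φ x + laplacian m f x • tension m n φ x
    + (2 : ℝ) • covAlong φ (tension m n φ) x (grad m f x)

end Maps

end FBiharm

end

/-! For an isometric immersion `∇dφ` takes normal values, so the tension field `τ` is normal and `η
= τ/m`. Minimality is therefore the vanishing of `τ` (`isMinimal_iff_tension`). The rest concerns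
`τ` alone, and neither the first variation formula nor integration by parts is used.

If `τ = 0`, every term of `τ_{2,f}` vanishes (`fBitension_eq_zero`). For a variation `Φ`, the field
`τ(Φ_t)` is smooth in `(t, x)` and zero at `t = 0`, so `|τ(Φ_t)|² = O(t²)` uniformly on compact
sets. The `f`-bienergy is then `O(t²)` and has derivative zero (`isFBiharmonic_of_tension_eq_zero`).

Conversely, suppose `τ_{2,f} = 0` for all positive `f`. The choice `f = 1` gives `τ₂ = 0`. For `f =
1 + q`, with `q` equal near `x₀` to the squared coordinate distance, the gradient vanishes at `x₀`
and `Δf(x₀) > 0`, so only `Δf · τ` survives and `τ(x₀) = 0` (`tension_eq_zero_of_fBitension`).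

Suppose instead that `φ` is critical for all positive `f`. Comparing `f = 1 + χ` with `f = 1`, for a
bump `χ` concentrated at `x₀`, localises criticality to the pointwise statement that `|τ(Φ_t)|²(x₀)`
has derivative at most zero (`derivative_normSq_tension_nonpos`). Moving `φ` in a chart by `δ sin t
· q · τ(x₀)` multiplies `τ(x₀)` by `1 + δL sin t` with `L > 0`. The derivative of its squared norm
is `2δL|τ(x₀)|²`, which forces `τ(x₀) = 0` (`tension_eq_zero_of_isFBiharmonic`).

The technical burden is smoothness of `τ`: it is defined pointwise, in charts centred at each point
and with chosen orthonormal bases. `coframe_tension` rewrites it as a trace in fixed charts. -/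

noncomputable section

namespace FBiharm

open Filter Topology

set_option synthInstance.maxHeartbeats 200000
set_option maxSynthPendingDepth 3

/-! ### Christoffel symbols and covariant Hessians on vector spaces -/

section Coordinates

variable {E F K : Type*} [NormedAddCommGroup E] [NormedSpace ℝ E]
  [NormedAddCommGroup F] [NormedSpace ℝ F] [NormedAddCommGroup K] [NormedSpace ℝ K]

/-- The Christoffel symbols of the first kind of a metric `G` on a vector space. -/
def chrLower (G : E → E →L[ℝ] E →L[ℝ] ℝ) (p : E) : E →L[ℝ] E →L[ℝ] E →L[ℝ] ℝ :=
  let D : E →L[ℝ] E →L[ℝ] E →L[ℝ] ℝ := fderiv ℝ G p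
  let T : (E →L[ℝ] E →L[ℝ] ℝ) →L[ℝ] (E →L[ℝ] E →L[ℝ] ℝ) :=
    (ContinuousLinearMap.flipₗᵢ ℝ E E ℝ).toContinuousLinearEquiv.toContinuousLinearMap
  (1 / 2 : ℝ) • (D + D.flip - T.comp D.flip)

theorem chrLower_apply (G : E → E →L[ℝ] E →L[ℝ] ℝ) (p u w e : E) :
    chrLower G p u w e = (1 / 2 : ℝ) * (fderiv ℝ G p u w e + fderiv ℝ G p w u e
      - fderiv ℝ G p e u w) := by
  simp [chrLower]

/-- The Christoffel symbols of a metric `G` on a vector space. -/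
def chr (G : E → E →L[ℝ] E →L[ℝ] ℝ) (p : E) : E →L[ℝ] E →L[ℝ] E :=
  (ContinuousLinearMap.compL ℝ E (E →L[ℝ] ℝ) E (G p).inverse).comp (chrLower G p)

theorem chr_apply (G : E → E →L[ℝ] E →L[ℝ] ℝ) (p u w : E) :
    chr G p u w = (G p).inverse (chrLower G p u w) := rfl

/-- This is the Koszul formula in coordinates. Invertibility matters because `inverse` has the
default value zero otherwise. -/
theorem metric_chr {G : E → E →L[ℝ] E →L[ℝ] ℝ} {p : E} (hG : (G p).IsInvertible) (u w e : E) :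
    G p (chr G p u w) e = (1 / 2 : ℝ) * (fderiv ℝ G p u w e + fderiv ℝ G p w u e
      - fderiv ℝ G p e u w) := by
  rw [chr_apply, hG.self_apply_inverse, chrLower_apply]

/-- The covariant Hessian `∇dψ` of a map `ψ` between vector spaces with metrics `G` and `H`. -/
def hess (G : E → E →L[ℝ] E →L[ℝ] ℝ) (H : F → F →L[ℝ] F →L[ℝ] ℝ) (ψ : E → F) (p : E) :
    E →L[ℝ] E →L[ℝ] F :=
  fderiv ℝ (fderiv ℝ ψ) p
    + (chr H (ψ p)).bilinearComp (fderiv ℝ ψ p) (fderiv ℝ ψ p)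
    - (ContinuousLinearMap.compL ℝ E E F (fderiv ℝ ψ p)).comp (chr G p)

theorem hess_apply (G : E → E →L[ℝ] E →L[ℝ] ℝ) (H : F → F →L[ℝ] F →L[ℝ] ℝ) (ψ : E → F)
    (p u w : E) :
    hess G H ψ p u w = fderiv ℝ (fderiv ℝ ψ) p u w
      + chr H (ψ p) (fderiv ℝ ψ p u) (fderiv ℝ ψ p w) - fderiv ℝ ψ p (chr G p u w) := by
  simp [hess]

theorem hess_congr {G : E → E →L[ℝ] E →L[ℝ] ℝ} {H : F → F →L[ℝ] F →L[ℝ] ℝ} {ψ χ : E → F} {p : E}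
    (h : ψ =ᶠ[𝓝 p] χ) : hess G H ψ p = hess G H χ p := by
  ext u w
  simp only [hess_apply, h.fderiv_eq, h.fderiv.fderiv_eq, h.eq_of_nhds]

/-- The Hessian of a map which pulls back `H` to `G` is orthogonal to the image of its
derivative. -/
theorem hess_normal {G : E → E →L[ℝ] E →L[ℝ] ℝ} {H : F → F →L[ℝ] F →L[ℝ] ℝ} {ψ : E → F} {p : E}
    (hψ : ContDiffAt ℝ 2 ψ p) (hH : DifferentiableAt ℝ H (ψ p))
    (hsymm : ∀ᶠ q in 𝓝 (ψ p), ∀ u w, H q u w = H q w u)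
    (hGi : (G p).IsInvertible) (hHi : (H (ψ p)).IsInvertible)
    (hG : ∀ᶠ q in 𝓝 p, ∀ u w, G q u w = H (ψ q) (fderiv ℝ ψ q u) (fderiv ℝ ψ q w)) (u w e : E) :
    H (ψ p) (hess G H ψ p u w) (fderiv ℝ ψ p e) = 0 := by
  have hd : DifferentiableAt ℝ ψ p := hψ.differentiableAt (by norm_num)
  have hdd : DifferentiableAt ℝ (fderiv ℝ ψ) p :=
    (hψ.fderiv_right (m := 1) (by norm_num)).differentiableAt (by norm_num)
  have hs2 : ∀ a b, fderiv ℝ (fderiv ℝ ψ) p a b = fderiv ℝ (fderiv ℝ ψ) p b a :=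
    hψ.isSymmSndFDerivAt (by simp)
  have hGeq : G =ᶠ[𝓝 p] fun q ↦ (H (ψ q)).bilinearComp (fderiv ℝ ψ q) (fderiv ℝ ψ q) := by
    filter_upwards [hG] with q hq
    ext a b
    simp [hq a b]
  have hHψ : HasFDerivAt (fun q ↦ H (ψ q)) ((fderiv ℝ H (ψ p)).comp (fderiv ℝ ψ p)) p :=
    HasFDerivAt.comp (g := H) p hH.hasFDerivAt hd.hasFDerivAt
  have key0 : ∀ a b, HasFDerivAt (fun q ↦ H (ψ q) (fderiv ℝ ψ q a) (fderiv ℝ ψ q b)) _ p :=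
    fun a b ↦ (hHψ.clm_apply (hdd.hasFDerivAt.clm_apply (hasFDerivAt_const a p))).clm_apply
      (hdd.hasFDerivAt.clm_apply (hasFDerivAt_const b p))
  -- `G` inherits differentiability at `p` from the pull-back expression that it equals nearby.
  have hGd : DifferentiableAt ℝ G p := by
    have : DifferentiableAt ℝ
        (fun q ↦ (H (ψ q)).bilinearComp (fderiv ℝ ψ q) (fderiv ℝ ψ q)) p := by
      unfold ContinuousLinearMap.bilinearComp
      have h1 := hHψ.differentiableAt.clm_comp hdd
      have hfl := ((ContinuousLinearMap.flipₗᵢ ℝ E F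
        ℝ).toContinuousLinearEquiv.toContinuousLinearMap).differentiableAt.comp p h1
      have h2 := DifferentiableAt.clm_comp hfl hdd
      exact ((ContinuousLinearMap.flipₗᵢ ℝ E E
        ℝ).toContinuousLinearEquiv.toContinuousLinearMap).differentiableAt.comp p h2
    exact this.congr_of_eventuallyEq hGeq
  have key : ∀ c a b, fderiv ℝ G p c a b =
      fderiv ℝ H (ψ p) (fderiv ℝ ψ p c) (fderiv ℝ ψ p a) (fderiv ℝ ψ p b)
      + H (ψ p) (fderiv ℝ (fderiv ℝ ψ) p c a) (fderiv ℝ ψ p b)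
      + H (ψ p) (fderiv ℝ ψ p a) (fderiv ℝ (fderiv ℝ ψ) p c b) := by
    intro c a b
    have e1 : HasFDerivAt (fun q ↦ G q a b) _ p :=
      (hGd.hasFDerivAt.clm_apply (hasFDerivAt_const a p)).clm_apply (hasFDerivAt_const b p)
    have e2 : (fun q ↦ G q a b) =ᶠ[𝓝 p] fun q ↦ H (ψ q) (fderiv ℝ ψ q a) (fderiv ℝ ψ q b) := by
      filter_upwards [hG] with q hq using hq a b
    have e3 := congrArg (fun L : E →L[ℝ] ℝ ↦ L c)
      (e1.unique ((key0 a b).congr_of_eventuallyEq e2))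
    simp only [_root_.add_apply, ContinuousLinearMap.comp_apply,
      ContinuousLinearMap.flip_apply, _root_.zero_apply, map_zero, zero_add] at e3
    rw [e3]
    ring
  have hHs := hsymm.self_of_nhds
  -- With the Koszul formula on both sides, the derivatives of `H` cancel. By symmetry the
  -- derivatives of `G` contribute exactly one `D²ψ(u, w)` paired with `e`, which cancels the
  -- remaining term.
  rw [hess_apply, map_sub, map_add, _root_.sub_apply, _root_.add_apply,
    metric_chr hHi, ← hG.self_of_nhds, metric_chr hGi, key, key, key, hs2 w u, hs2 u e, hs2 w e,
    hs2 e w, hHs (fderiv ℝ (fderiv ℝ ψ) p e u)]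
  ring

/-- The composition formula for covariant Hessians. -/
theorem hess_comp {G : E → E →L[ℝ] E →L[ℝ] ℝ} {H : F → F →L[ℝ] F →L[ℝ] ℝ}
    {J : K → K →L[ℝ] K →L[ℝ] ℝ} {ψ : E → F} {χ : F → K} {p : E}
    (hψ : ContDiffAt ℝ 2 ψ p) (hχ : ContDiffAt ℝ 2 χ (ψ p)) (u w : E) :
    hess G J (χ ∘ ψ) p u w = fderiv ℝ χ (ψ p) (hess G H ψ p u w)
      + hess H J χ (ψ p) (fderiv ℝ ψ p u) (fderiv ℝ ψ p w) := by
  have hd : DifferentiableAt ℝ ψ p := hψ.differentiableAt (by norm_num)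
  have hdd : DifferentiableAt ℝ (fderiv ℝ ψ) p :=
    (hψ.fderiv_right (m := 1) (by norm_num)).differentiableAt (by norm_num)
  have hc : DifferentiableAt ℝ χ (ψ p) := hχ.differentiableAt (by norm_num)
  have hcc : DifferentiableAt ℝ (fderiv ℝ χ) (ψ p) :=
    (hχ.fderiv_right (m := 1) (by norm_num)).differentiableAt (by norm_num)
  have h1 : fderiv ℝ (χ ∘ ψ) =ᶠ[𝓝 p] fun q ↦ (fderiv ℝ χ (ψ q)).comp (fderiv ℝ ψ q) := by
    have a1 : ∀ᶠ q in 𝓝 p, ContDiffAt ℝ 2 ψ q := hψ.eventually (by simp)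
    have a2 : ∀ᶠ q in 𝓝 p, ContDiffAt ℝ 2 χ (ψ q) :=
      hd.continuousAt.eventually (hχ.eventually (by simp))
    filter_upwards [a1, a2] with q h1 h2
    exact fderiv_comp q (h2.differentiableAt (by norm_num)) (h1.differentiableAt (by norm_num))
  have h2 := (HasFDerivAt.clm_comp (hcc.hasFDerivAt.comp p hd.hasFDerivAt) hdd.hasFDerivAt).fderiv
  have h3 : fderiv ℝ (fderiv ℝ (χ ∘ ψ)) p = _ := h1.fderiv_eq.trans h2
  -- The Christoffel terms of the intermediate metric `H` enter with opposite signs, so `H` is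
  -- arbitrary.
  rw [hess_apply, hess_apply, hess_apply, h3, h1.self_of_nhds]
  simp
  abel

/-- Covariant Hessians are natural with respect to isometric changes of coordinates. -/
theorem hess_natural {E' F' : Type*} [NormedAddCommGroup E'] [NormedSpace ℝ E']
    [NormedAddCommGroup F'] [NormedSpace ℝ F']
    {G : E → E →L[ℝ] E →L[ℝ] ℝ} {H : F → F →L[ℝ] F →L[ℝ] ℝ}
    {G' : E' → E' →L[ℝ] E' →L[ℝ] ℝ} {H' : F' → F' →L[ℝ] F' →L[ℝ] ℝ}
    {ψ : E → F} {ψ' : E' → F'} {θ : E → E'} {κ : F → F'} {p : E}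
    (hψ : ContDiffAt ℝ 2 ψ p) (hψ' : ContDiffAt ℝ 2 ψ' (θ p))
    (hθ : ContDiffAt ℝ 2 θ p) (hκ : ContDiffAt ℝ 2 κ (ψ p))
    (hθ0 : hess G G' θ p = 0) (hκ0 : hess H H' κ (ψ p) = 0)
    (hcomm : κ ∘ ψ =ᶠ[𝓝 p] ψ' ∘ θ) (u w : E) :
    fderiv ℝ κ (ψ p) (hess G H ψ p u w)
      = hess G' H' ψ' (θ p) (fderiv ℝ θ p u) (fderiv ℝ θ p w) := by
  -- The Hessian of the common map `κ ∘ ψ = ψ' ∘ θ` is expanded in both ways; the Hessians of `κ`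
  -- and `θ` drop out.
  have h1 := hess_comp (G := G) (H := H) (J := H') hψ hκ u w
  have h2 := hess_comp (G := G) (H := G') (J := H') hθ hψ' u w
  rw [hess_congr hcomm, h2, hθ0, hκ0] at h1
  simpa using h1.symm

/-- A positive definite bilinear form on a finite-dimensional space is invertible. -/
theorem isInvertible_of_pos [FiniteDimensional ℝ E] {B : E →L[ℝ] E →L[ℝ] ℝ}
    (hB : ∀ u, u ≠ 0 → 0 < B u u) : B.IsInvertible := by
  have hinj : Function.Injective B := by
    rw [injective_iff_map_eq_zero]
    intro u hu
    by_contra h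
    have := hB u h
    simp [hu] at this
  have hfr : Module.finrank ℝ E = Module.finrank ℝ (E →L[ℝ] ℝ) := by
    rw [← (LinearMap.toContinuousLinearMap (𝕜 := ℝ) (E := E) (F' := ℝ)).finrank_eq]
    exact (Subspace.dual_finrank_eq (K := ℝ) (V := E)).symm
  let e := LinearEquiv.ofInjectiveOfFinrankEq (B : E →ₗ[ℝ] E →L[ℝ] ℝ) hinj hfr
  exact ⟨e.toContinuousLinearEquiv, by ext; rfl⟩

end Coordinates

/-! ### Traces with respect to a metric, and smooth dependence -/

section Trace

variable {k : ℕ} {F : Type*} [NormedAddCommGroup F] [NormedSpace ℝ F]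

local notation "𝔼" => EuclideanSpace ℝ (Fin k)

/-- The trace of a bilinear map with respect to a scalar product on Euclidean space. -/
def traceForm (g : 𝔼 →L[ℝ] 𝔼 →L[ℝ] ℝ) (L : 𝔼 →L[ℝ] 𝔼 →L[ℝ] F) : F :=
  ∑ i, L (g.inverse (EuclideanSpace.proj i)) (EuclideanSpace.single i 1)

/-- `traceForm` involves no choice of frame and so is visibly smooth in `g`, while `tension` uses
bases chosen point by point. To compare them, expand the standard basis in the frame `e`; moved to
the other slot, the coefficients recombine the `g`-duals of the coordinate functionals into `e j`.
-/
theorem traceForm_eq_sum {g : 𝔼 →L[ℝ] 𝔼 →L[ℝ] ℝ} (hg : g.IsInvertible)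
    (L : 𝔼 →L[ℝ] 𝔼 →L[ℝ] F) {e : Fin k → 𝔼}
    (he : ∀ i j, g (e i) (e j) = if i = j then 1 else 0) :
    traceForm g L = ∑ i, L (e i) (e i) := by
  have hli : LinearIndependent ℝ e := by
    rw [Fintype.linearIndependent_iff]
    intro c hc i
    have := congrArg (fun v ↦ g (e i) v) hc
    simpa [he, map_sum] using this
  let b := Module.Basis.mk hli (hli.span_eq_top_of_card_eq_finrank' (by simp)).ge
  have hb : ∀ i, b i = e i := fun i ↦ by simp [b]
  have hexp : ∀ v, v = ∑ j, g (e j) v • e j := by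
    intro v
    conv_lhs => rw [← b.sum_repr v]
    refine Finset.sum_congr rfl fun j _ ↦ ?_
    rw [hb]
    congr 1
    conv_rhs => rw [← b.sum_repr v]
    simp [map_sum, hb, he]
  have hdual : ∀ j, ∑ i, (g (e j) (EuclideanSpace.single i 1)) •
      g.inverse (EuclideanSpace.proj i) = e j := by
    intro j
    apply hg.injective
    rw [map_sum]
    ext v
    simp only [map_smul, hg.self_apply_inverse, _root_.sum_apply,
      _root_.smul_apply, PiLp.proj_apply, smul_eq_mul]
    conv_rhs => rw [← (EuclideanSpace.basisFun (Fin k) ℝ).sum_repr v]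
    simp [map_sum, mul_comm]
  calc traceForm g L
      = ∑ i, ∑ j, L (g.inverse (EuclideanSpace.proj i))
          (g (e j) (EuclideanSpace.single i 1) • e j) := by
        refine Finset.sum_congr rfl fun i _ ↦ ?_
        rw [← map_sum, ← hexp]
    _ = ∑ j, L (∑ i, (g (e j) (EuclideanSpace.single i 1)) •
          g.inverse (EuclideanSpace.proj i)) (e j) := by
        rw [Finset.sum_comm]
        refine Finset.sum_congr rfl fun j _ ↦ ?_
        simp [map_sum, _root_.sum_apply]
    _ = ∑ i, L (e i) (e i) := by simp only [hdual]

end Trace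

section Smoothness

variable {E F D : Type*} [NormedAddCommGroup E] [NormedSpace ℝ E]
  [NormedAddCommGroup F] [NormedSpace ℝ F] [NormedAddCommGroup D] [NormedSpace ℝ D]

theorem contDiffAt_clm_flip {f : D → E →L[ℝ] E →L[ℝ] F} {x : D} (hf : ContDiffAt ℝ ∞ f x) :
    ContDiffAt ℝ ∞ (fun y ↦ (f y).flip) x := by
  let T : (E →L[ℝ] E →L[ℝ] F) →L[ℝ] (E →L[ℝ] E →L[ℝ] F) :=
    (ContinuousLinearMap.flipₗᵢ ℝ E E F).toContinuousLinearEquiv.toContinuousLinearMap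
  exact T.contDiff.contDiffAt.comp x hf

theorem contDiffAt_chr [CompleteSpace E] {G : E → E →L[ℝ] E →L[ℝ] ℝ} {a u w : D → E} {x : D}
    (hG : ContDiffAt ℝ ∞ G (a x)) (hGi : (G (a x)).IsInvertible)
    (ha : ContDiffAt ℝ ∞ a x) (hu : ContDiffAt ℝ ∞ u x) (hw : ContDiffAt ℝ ∞ w x) :
    ContDiffAt ℝ ∞ (fun y ↦ chr G (a y) (u y) (w y)) x := by
  have hD : ContDiffAt ℝ ∞ (fun y ↦ fderiv ℝ G (a y)) x :=
    ContDiffAt.comp (g := fderiv ℝ G) x (hG.fderiv_right (m := ∞) (by simp)) ha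
  have hi : ContDiffAt ℝ ∞ (fun y ↦ (G (a y)).inverse) x :=
    ContDiffAt.comp (g := ContinuousLinearMap.inverse) x hGi.contDiffAt_map_inverse
      (ContDiffAt.comp (g := G) x hG ha)
  have hlow : ContDiffAt ℝ ∞ (fun y ↦ (1 / 2 : ℝ) • (fderiv ℝ G (a y) (u y) (w y)
      + fderiv ℝ G (a y) (w y) (u y) - ((fderiv ℝ G (a y)).flip (u y)).flip (w y))) x :=
    ((((hD.clm_apply hu).clm_apply hw).add ((hD.clm_apply hw).clm_apply hu)).sub
      ((contDiffAt_clm_flip ((contDiffAt_clm_flip hD).clm_apply hu)).clm_apply hw)).const_smul _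
  refine (hi.clm_apply hlow).congr_of_eventuallyEq (Eventually.of_forall fun y ↦ ?_)
  simp only [chr_apply]
  congr 1

variable {k : ℕ}

local notation "𝔼" => EuclideanSpace ℝ (Fin k)

/-- The tension field, in coordinates, depends smoothly on the point and on parameters. -/
theorem contDiffAt_traceForm_hess [CompleteSpace F] {G : 𝔼 → 𝔼 →L[ℝ] 𝔼 →L[ℝ] ℝ}
    {H : F → F →L[ℝ] F →L[ℝ] ℝ} {Ψ : D × 𝔼 → F} {z : D × 𝔼}
    (hΨ : ContDiffAt ℝ ∞ Ψ z) (hG : ContDiffAt ℝ ∞ G z.2) (hGi : (G z.2).IsInvertible)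
    (hH : ContDiffAt ℝ ∞ H (Ψ z)) (hHi : (H (Ψ z)).IsInvertible) :
    ContDiffAt ℝ ∞
      (fun y : D × 𝔼 ↦ traceForm (G y.2) (hess G H (fun q ↦ Ψ (y.1, q)) y.2)) z := by
  have hD : ContDiffAt ℝ ∞ (fun y : D × 𝔼 ↦ fderiv ℝ (fun q ↦ Ψ (y.1, q)) y.2) z := by
    refine ContDiffAt.fderiv (f := fun (y : D × 𝔼) q ↦ Ψ (y.1, q)) (n := ∞) (m := ∞) ?_
      contDiffAt_snd (by simp)
    exact ContDiffAt.comp (g := Ψ) (z, z.2) hΨ (by fun_prop)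
  have hDD : ContDiffAt ℝ ∞
      (fun y : D × 𝔼 ↦ fderiv ℝ (fderiv ℝ (fun q ↦ Ψ (y.1, q))) y.2) z := by
    refine ContDiffAt.fderiv (f := fun (y : D × 𝔼) q ↦ fderiv ℝ (fun q ↦ Ψ (y.1, q)) q)
      (n := ∞) (m := ∞) ?_ contDiffAt_snd (by simp)
    exact ContDiffAt.comp (g := fun y : D × 𝔼 ↦ fderiv ℝ (fun q ↦ Ψ (y.1, q)) y.2) (z, z.2) hD
      (f := fun y : (D × 𝔼) × 𝔼 ↦ (y.1.1, y.2)) (by fun_prop)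
  have hi : ContDiffAt ℝ ∞ (fun y : D × 𝔼 ↦ (G y.2).inverse) z :=
    ContDiffAt.comp (g := ContinuousLinearMap.inverse) z hGi.contDiffAt_map_inverse
      (ContDiffAt.comp (g := G) z hG contDiffAt_snd)
  unfold traceForm
  refine ContDiffAt.sum fun i _ ↦ ?_
  simp only [hess_apply]
  have hu : ContDiffAt ℝ ∞ (fun y : D × 𝔼 ↦ (G y.2).inverse (EuclideanSpace.proj i)) z :=
    hi.clm_apply contDiffAt_const
  have hw : ContDiffAt ℝ ∞ (fun _ : D × 𝔼 ↦ (EuclideanSpace.single i 1 : 𝔼)) z :=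
    contDiffAt_const
  refine (((hDD.clm_apply hu).clm_apply hw).add ?_).sub ?_
  · exact contDiffAt_chr (a := fun y : D × 𝔼 ↦ Ψ (y.1, y.2)) hH hHi hΨ (hD.clm_apply hu)
      (hD.clm_apply hw)
  · exact hD.clm_apply (contDiffAt_chr hG hGi contDiffAt_snd hu hw)

end Smoothness

/-! ### Tangent vectors, derivatives and maps in preferred charts -/

section Frames

variable {n : ℕ} {N : Type*} [TopologicalSpace N] [ChartedSpace (EuclideanSpace ℝ (Fin n)) N]
  [IsManifold (𝓡 n) ∞ N]

/-- The components of tangent vectors at `z` in the preferred chart at `y₀`. -/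
def coframe (y₀ z : N) : TangentSpace (𝓡 n) z →L[ℝ] EuclideanSpace ℝ (Fin n) :=
  (trivializationAt (EuclideanSpace ℝ (Fin n)) (TangentSpace (𝓡 n) : N → Type _)
    y₀).continuousLinearMapAt ℝ z

/-- The tangent vector at `z` with given components in the preferred chart at `y₀`. -/
def frame (y₀ z : N) : EuclideanSpace ℝ (Fin n) →L[ℝ] TangentSpace (𝓡 n) z :=
  (trivializationAt (EuclideanSpace ℝ (Fin n)) (TangentSpace (𝓡 n) : N → Type _) y₀).symmL ℝ z

theorem mem_baseSet {y₀ z : N} (hz : z ∈ (extChartAt (𝓡 n) y₀).source) :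
    z ∈ (trivializationAt (EuclideanSpace ℝ (Fin n)) (TangentSpace (𝓡 n) : N → Type _)
      y₀).baseSet := by
  simpa using hz

theorem coframe_frame {y₀ z : N} (hz : z ∈ (extChartAt (𝓡 n) y₀).source)
    (u : EuclideanSpace ℝ (Fin n)) : coframe y₀ z (frame y₀ z u) = u :=
  Trivialization.continuousLinearMapAt_symmL _ (mem_baseSet hz) u

theorem frame_coframe {y₀ z : N} (hz : z ∈ (extChartAt (𝓡 n) y₀).source)
    (u : TangentSpace (𝓡 n) z) : frame y₀ z (coframe y₀ z u) = u :=
  Trivialization.symmL_continuousLinearMapAt _ (mem_baseSet hz) u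

theorem trivialization_snd {y₀ z : N} (hz : z ∈ (extChartAt (𝓡 n) y₀).source)
    (u : TangentSpace (𝓡 n) z) :
    (trivializationAt (EuclideanSpace ℝ (Fin n)) (TangentSpace (𝓡 n) : N → Type _) y₀ ⟨z, u⟩).2
      = coframe y₀ z u := by
  rw [coframe, Trivialization.continuousLinearMapAt_apply,
    Trivialization.coe_linearMapAt_of_mem _ (mem_baseSet hz)]

theorem constField_eq {y z : N} (hz : z ∈ (extChartAt (𝓡 n) y).source)
    (u : TangentSpace (𝓡 n) y) :
    constField u z = frame y z (coframe y y u) := by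
  rw [← trivialization_snd (mem_extChartAt_source y), frame,
    Trivialization.symmL_apply _ (mem_baseSet hz)]
  rfl

theorem coframe_eq_mvfderiv {y₀ z : N} (hz : z ∈ (extChartAt (𝓡 n) y₀).source)
    (u : TangentSpace (𝓡 n) z) : coframe y₀ z u = mvfderiv (𝓡 n) (extChartAt (𝓡 n) y₀) z u := by
  have : IsManifold (𝓡 n) 1 N := IsManifold.of_le (n := ∞) (by simp)
  rw [coframe, TangentBundle.continuousLinearMapAt_trivializationAt (by simpa using hz)]
  rfl

variable {V : Type*} [NormedAddCommGroup V] [NormedSpace ℝ V]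

omit [IsManifold (𝓡 n) ∞ N] in
theorem mvfderiv_congr {f g : N → V} {z : N} (h : f =ᶠ[𝓝 z] g) :
    (mvfderiv (𝓡 n) f z : TangentSpace (𝓡 n) z → V) = mvfderiv (𝓡 n) g z := by
  ext u
  simp only [mvfderiv, ContinuousLinearMap.comp_apply]
  rw [h.mfderiv_eq]
  rfl

omit [IsManifold (𝓡 n) ∞ N] in
theorem mvfderiv_comp_apply_of_mdifferentiableAt {m : ℕ} {M : Type*} [TopologicalSpace M]
    [ChartedSpace (EuclideanSpace ℝ (Fin m)) M] {g : N → V} {f : M → N} {x : M}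
    (hg : MDifferentiableAt (𝓡 n) 𝓘(ℝ, V) g (f x)) (hf : MDifferentiableAt (𝓡 m) (𝓡 n) f x)
    (v : TangentSpace (𝓡 m) x) :
    mvfderiv (𝓡 m) (g ∘ f) x v = mvfderiv (𝓡 n) g (f x) (mfderiv (𝓡 m) (𝓡 n) f x v) :=
  mfderiv_comp_apply x hg hf v

/-- The chart centre `y₀` need not be `z`, so derivatives at nearby points can be compared in one
chart and differentiated again. -/
theorem mvfderiv_eq_fderiv {f : N → V} {y₀ z : N} (hz : z ∈ (extChartAt (𝓡 n) y₀).source)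
    (hf : DifferentiableAt ℝ (f ∘ (extChartAt (𝓡 n) y₀).symm) (extChartAt (𝓡 n) y₀ z))
    (u : TangentSpace (𝓡 n) z) :
    mvfderiv (𝓡 n) f z u
      = fderiv ℝ (f ∘ (extChartAt (𝓡 n) y₀).symm) (extChartAt (𝓡 n) y₀ z) (coframe y₀ z u) := by
  have : IsManifold (𝓡 n) 1 N := IsManifold.of_le (n := ∞) (by simp)
  have h1 : f =ᶠ[𝓝 z] (f ∘ (extChartAt (𝓡 n) y₀).symm) ∘ extChartAt (𝓡 n) y₀ := by
    filter_upwards [extChartAt_source_mem_nhds' (I := 𝓡 n) hz] with w hw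
    simp only [Function.comp_apply, (extChartAt (𝓡 n) y₀).left_inv hw]
  rw [mvfderiv_congr h1, coframe_eq_mvfderiv hz]
  have h2 := mfderiv_comp_apply z hf.mdifferentiableAt
    (mdifferentiableAt_extChartAt (I := 𝓡 n) (by simpa using hz)) u
  rw [mfderiv_eq_fderiv] at h2
  exact h2

end Frames

section Maps

variable {m n : ℕ}
  {M : Type*} [TopologicalSpace M] [ChartedSpace (EuclideanSpace ℝ (Fin m)) M]
  [IsManifold (𝓡 m) ∞ M]
  {N : Type*} [TopologicalSpace N] [ChartedSpace (EuclideanSpace ℝ (Fin n)) N]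
  [IsManifold (𝓡 n) ∞ N]

variable (m n) in
/-- The coordinate representation of a map in the preferred charts at `x₀` and `y₀`. -/
def coordMap (φ : M → N) (x₀ : M) (y₀ : N) :
    EuclideanSpace ℝ (Fin m) → EuclideanSpace ℝ (Fin n) :=
  extChartAt (𝓡 n) y₀ ∘ φ ∘ (extChartAt (𝓡 m) x₀).symm

omit [IsManifold (𝓡 m) ∞ M] [IsManifold (𝓡 n) ∞ N] in
theorem coordMap_extChartAt (φ : M → N) {x₀ x : M} (y₀ : N)
    (hx : x ∈ (extChartAt (𝓡 m) x₀).source) :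
    coordMap m n φ x₀ y₀ (extChartAt (𝓡 m) x₀ x) = extChartAt (𝓡 n) y₀ (φ x) := by
  simp only [coordMap, Function.comp_apply, (extChartAt (𝓡 m) x₀).left_inv hx]

theorem contDiffAt_coordMap {φ : M → N} {x₀ x : M} {y₀ : N}
    (hφ : ContMDiffAt (𝓡 m) (𝓡 n) ∞ φ x) (hx : x ∈ (extChartAt (𝓡 m) x₀).source)
    (hy : φ x ∈ (extChartAt (𝓡 n) y₀).source) :
    ContDiffAt ℝ ∞ (coordMap m n φ x₀ y₀) (extChartAt (𝓡 m) x₀ x) := by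
  have hx' : (extChartAt (𝓡 m) x₀).symm (extChartAt (𝓡 m) x₀ x) = x :=
    (extChartAt (𝓡 m) x₀).left_inv hx
  rw [← contMDiffAt_iff_contDiffAt]
  have h1 : ContMDiffAt 𝓘(ℝ, EuclideanSpace ℝ (Fin m)) (𝓡 m) ∞ (extChartAt (𝓡 m) x₀).symm
      (extChartAt (𝓡 m) x₀ x) :=
    (contMDiffOn_extChartAt_symm x₀).contMDiffAt
      (extChartAt_target_mem_nhds' ((extChartAt (𝓡 m) x₀).map_source hx))
  have h2 : ContMDiffAt (𝓡 n) 𝓘(ℝ, EuclideanSpace ℝ (Fin n)) ∞ (extChartAt (𝓡 n) y₀) (φ x) :=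
    contMDiffAt_extChartAt' (by simpa using hy)
  exact ContMDiffAt.comp_of_eq (g := extChartAt (𝓡 n) y₀ ∘ φ) (I' := 𝓡 m) (h2.comp x hφ) h1 hx'

theorem coframe_mfderiv {φ : M → N} {x₀ x : M} {y₀ : N}
    (hφ : ContMDiffAt (𝓡 m) (𝓡 n) ∞ φ x) (hx : x ∈ (extChartAt (𝓡 m) x₀).source)
    (hy : φ x ∈ (extChartAt (𝓡 n) y₀).source) (u : TangentSpace (𝓡 m) x) :
    coframe y₀ (φ x) (mfderiv (𝓡 m) (𝓡 n) φ x u)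
      = fderiv ℝ (coordMap m n φ x₀ y₀) (extChartAt (𝓡 m) x₀ x) (coframe x₀ x u) := by
  have : IsManifold (𝓡 n) 1 N := IsManifold.of_le (n := ∞) (by simp)
  rw [coframe_eq_mvfderiv hy, ← mvfderiv_comp_apply_of_mdifferentiableAt
    (mdifferentiableAt_extChartAt (I := 𝓡 n) (by simpa using hy)) (hφ.mdifferentiableAt (by simp))]
  exact mvfderiv_eq_fderiv (f := extChartAt (𝓡 n) y₀ ∘ φ) hx
    ((contDiffAt_coordMap hφ hx hy).differentiableAt (by simp)) u

end Maps

/-! ### The metric and the Levi-Civita connection in coordinates -/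

section Metric

variable {n : ℕ} {N : Type*} [TopologicalSpace N] [ChartedSpace (EuclideanSpace ℝ (Fin n)) N]
  [IsManifold (𝓡 n) ∞ N] [RiemannianBundle (fun y : N ↦ TangentSpace (𝓡 n) y)]

/-- The metric in the preferred chart at `y₀`. -/
def metricCoord (y₀ : N) (p : EuclideanSpace ℝ (Fin n)) :
    EuclideanSpace ℝ (Fin n) →L[ℝ] EuclideanSpace ℝ (Fin n) →L[ℝ] ℝ :=
  (innerSL ℝ (E := TangentSpace (𝓡 n) ((extChartAt (𝓡 n) y₀).symm p))).bilinearComp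
    (frame y₀ ((extChartAt (𝓡 n) y₀).symm p)) (frame y₀ ((extChartAt (𝓡 n) y₀).symm p))

theorem metricCoord_apply (y₀ : N) (p u w : EuclideanSpace ℝ (Fin n)) :
    metricCoord y₀ p u w = inner ℝ (frame y₀ ((extChartAt (𝓡 n) y₀).symm p) u)
      (frame y₀ ((extChartAt (𝓡 n) y₀).symm p) w) := rfl

theorem metricCoord_extChartAt {y₀ z : N} (hz : z ∈ (extChartAt (𝓡 n) y₀).source)
    (u w : EuclideanSpace ℝ (Fin n)) :
    metricCoord y₀ (extChartAt (𝓡 n) y₀ z) u w = inner ℝ (frame y₀ z u) (frame y₀ z w) := by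
  rw [metricCoord_apply, (extChartAt (𝓡 n) y₀).left_inv hz]

theorem metricCoord_coframe {y₀ z : N} (hz : z ∈ (extChartAt (𝓡 n) y₀).source)
    (u w : TangentSpace (𝓡 n) z) :
    metricCoord y₀ (extChartAt (𝓡 n) y₀ z) (coframe y₀ z u) (coframe y₀ z w) = inner ℝ u w := by
  rw [metricCoord_extChartAt hz, frame_coframe hz, frame_coframe hz]

theorem metricCoord_symm (y₀ : N) (p u w : EuclideanSpace ℝ (Fin n)) :
    metricCoord y₀ p u w = metricCoord y₀ p w u := by
  rw [metricCoord_apply, metricCoord_apply, real_inner_comm]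

theorem metricCoord_isInvertible {y₀ : N} {p : EuclideanSpace ℝ (Fin n)}
    (hp : p ∈ (extChartAt (𝓡 n) y₀).target) : (metricCoord y₀ p).IsInvertible := by
  refine isInvertible_of_pos fun u hu ↦ ?_
  rw [metricCoord_apply, real_inner_self_eq_norm_sq]
  have : frame y₀ ((extChartAt (𝓡 n) y₀).symm p) u ≠ 0 := by
    intro h
    apply hu
    rw [← coframe_frame ((extChartAt (𝓡 n) y₀).map_target hp) u, h, map_zero]
  positivity

variable [IsContMDiffRiemannianBundle (𝓡 n) ∞ (EuclideanSpace ℝ (Fin n))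
      (fun y : N ↦ TangentSpace (𝓡 n) y)]

theorem contMDiffAt_inner_frame {y₀ z : N} (hz : z ∈ (extChartAt (𝓡 n) y₀).source)
    (u w : EuclideanSpace ℝ (Fin n)) :
    ContMDiffAt (𝓡 n) 𝓘(ℝ, ℝ) ∞ (fun z ↦ (inner ℝ (frame y₀ z u) (frame y₀ z w) : ℝ)) z := by
  have hs : ∀ u, ContMDiffAt (𝓡 n) ((𝓡 n).prod 𝓘(ℝ, EuclideanSpace ℝ (Fin n))) ∞
      (fun z ↦ (⟨z, frame y₀ z u⟩ : TangentBundle (𝓡 n) N)) z := by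
    intro u
    rw [Trivialization.contMDiffAt_section_iff (trivializationAt (EuclideanSpace ℝ (Fin n))
      (TangentSpace (𝓡 n) : N → Type _) y₀) (mem_baseSet hz)]
    refine (contMDiffAt_const (c := u)).congr_of_eventuallyEq ?_
    filter_upwards [extChartAt_source_mem_nhds' (I := 𝓡 n) hz] with w hw
    rw [trivialization_snd hw, coframe_frame hw]
  exact (hs u).inner_bundle (hs w)

theorem contDiffAt_metricCoord {y₀ : N} {p : EuclideanSpace ℝ (Fin n)}
    (hp : p ∈ (extChartAt (𝓡 n) y₀).target) : ContDiffAt ℝ ∞ (metricCoord y₀) p := by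
  have hopen : IsOpen (extChartAt (𝓡 n) y₀).target := isOpen_extChartAt_target y₀
  refine ContDiffOn.contDiffAt ?_ (hopen.mem_nhds hp)
  rw [contDiffOn_clm_apply]
  intro u
  rw [contDiffOn_clm_apply]
  intro w q hq
  apply ContDiffAt.contDiffWithinAt
  rw [← contMDiffAt_iff_contDiffAt]
  exact (contMDiffAt_inner_frame ((extChartAt (𝓡 n) y₀).map_target hq) u w).comp q
    ((contMDiffOn_extChartAt_symm y₀).contMDiffAt (hopen.mem_nhds hq))

end Metric

section Christoffel

variable {n : ℕ} {N : Type*} [TopologicalSpace N] [ChartedSpace (EuclideanSpace ℝ (Fin n)) N]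
  [IsManifold (𝓡 n) ∞ N] [RiemannianBundle (fun y : N ↦ TangentSpace (𝓡 n) y)]
  [IsContMDiffRiemannianBundle (𝓡 n) ∞ (EuclideanSpace ℝ (Fin n))
      (fun y : N ↦ TangentSpace (𝓡 n) y)]

theorem derivInner_constField {y : N} (u w e : TangentSpace (𝓡 n) y) :
    derivInner (constField u) (constField w) e
      = fderiv ℝ (metricCoord y) (extChartAt (𝓡 n) y y) (coframe y y e) (coframe y y u)
          (coframe y y w) := by
  have hd : DifferentiableAt ℝ (metricCoord y) (extChartAt (𝓡 n) y y) :=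
    (contDiffAt_metricCoord (mem_extChartAt_target y)).differentiableAt (by simp)
  have h1 : ((fun z : N ↦ (inner ℝ (constField u z) (constField w z) : ℝ)) ∘
      (extChartAt (𝓡 n) y).symm) =ᶠ[𝓝 (extChartAt (𝓡 n) y y)]
      fun p ↦ metricCoord y p (coframe y y u) (coframe y y w) := by
    filter_upwards [extChartAt_target_mem_nhds (I := 𝓡 n) y] with p hp
    have := (extChartAt (𝓡 n) y).map_target hp
    simp only [Function.comp_apply, constField_eq this, metricCoord_apply]
  have h2 := (hd.hasFDerivAt.clm_apply (hasFDerivAt_const (coframe y y u) _)).clm_apply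
    (hasFDerivAt_const (coframe y y w) _)
  have h3 := h2.congr_of_eventuallyEq h1
  rw [derivInner, mvfderiv_eq_fderiv (mem_extChartAt_source y) h3.differentiableAt, h3.fderiv]
  simp

/-- The Christoffel term of the Levi-Civita connection in the preferred chart. -/
theorem coframe_christoffel (y : N) (u w : TangentSpace (𝓡 n) y) :
    coframe y y (christoffel y u w)
      = chr (metricCoord y) (extChartAt (𝓡 n) y y) (coframe y y u) (coframe y y w) := by
  have hy := mem_extChartAt_source (I := 𝓡 n) y
  have key : frame y y (chr (metricCoord y) (extChartAt (𝓡 n) y y) (coframe y y u)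
      (coframe y y w)) = christoffel y u w := by
    rw [← (onb n y).sum_repr' (frame y y _), christoffel]
    refine Finset.sum_congr rfl fun a _ ↦ ?_
    congr 1
    rw [real_inner_comm, ← metricCoord_coframe hy, coframe_frame hy,
      metric_chr (metricCoord_isInvertible (mem_extChartAt_target y)), derivInner_constField,
      derivInner_constField, derivInner_constField]
  rw [← key, coframe_frame hy]

variable {m : ℕ} {M : Type*} [TopologicalSpace M] [ChartedSpace (EuclideanSpace ℝ (Fin m)) M]
  [IsManifold (𝓡 m) ∞ M]

/-- The covariant derivative along a map, in coordinates. -/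
theorem coframe_covAlong {φ : M → N} {x : M} (hφ : ContMDiffAt (𝓡 m) (𝓡 n) ∞ φ x)
    (W : Π x : M, TangentSpace (𝓡 n) (φ x)) (v : TangentSpace (𝓡 m) x)
    (hW : DifferentiableAt ℝ (localRep φ W x ∘ (extChartAt (𝓡 m) x).symm) (extChartAt (𝓡 m) x x)) :
    coframe (φ x) (φ x) (covAlong φ W x v)
      = fderiv ℝ (localRep φ W x ∘ (extChartAt (𝓡 m) x).symm) (extChartAt (𝓡 m) x x)
          (coframe x x v)
        + chr (metricCoord (φ x)) (extChartAt (𝓡 n) (φ x) (φ x))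
          (fderiv ℝ (coordMap m n φ x (φ x)) (extChartAt (𝓡 m) x x) (coframe x x v))
          (coframe (φ x) (φ x) (W x)) := by
  have hx := mem_extChartAt_source (I := 𝓡 m) x
  have hy := mem_extChartAt_source (I := 𝓡 n) (φ x)
  rw [covAlong, map_add, coframe_christoffel, coframe_mfderiv hφ hx hy,
    mvfderiv_eq_fderiv hx hW, ← Trivialization.symmL_apply (R := ℝ) _ (mem_baseSet hy)]
  congr 1
  exact coframe_frame hy _

/-- A field with constant components in the chart at `x` is pushed to one with components `Dψ(p) e`,
whose derivative is the second derivative of the coordinate map `ψ`. -/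
theorem coframe_covAlong_pushField [RiemannianBundle (fun x : M ↦ TangentSpace (𝓡 m) x)]
    {φ : M → N} {x : M} (hφ : ContMDiff (𝓡 m) (𝓡 n) ∞ φ) (e v : TangentSpace (𝓡 m) x) :
    coframe (φ x) (φ x) (covAlong φ (pushField m n φ (constField e)) x v)
      = fderiv ℝ (fderiv ℝ (coordMap m n φ x (φ x))) (extChartAt (𝓡 m) x x) (coframe x x v)
          (coframe x x e)
        + chr (metricCoord (φ x)) (extChartAt (𝓡 n) (φ x) (φ x))
          (fderiv ℝ (coordMap m n φ x (φ x)) (extChartAt (𝓡 m) x x) (coframe x x v))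
          (fderiv ℝ (coordMap m n φ x (φ x)) (extChartAt (𝓡 m) x x) (coframe x x e)) := by
  have hx := mem_extChartAt_source (I := 𝓡 m) x
  have hy := mem_extChartAt_source (I := 𝓡 n) (φ x)
  have hc := contDiffAt_coordMap hφ.contMDiffAt hx hy
  have hcont : ContinuousAt (fun p ↦ φ ((extChartAt (𝓡 m) x).symm p)) (extChartAt (𝓡 m) x x) := by
    refine ContinuousAt.comp (g := φ) ?_ (continuousAt_extChartAt_symm x)
    rw [extChartAt_to_inv]
    exact hφ.continuous.continuousAt
  have h1 : (localRep φ (pushField m n φ (constField e)) x ∘ (extChartAt (𝓡 m) x).symm)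
      =ᶠ[𝓝 (extChartAt (𝓡 m) x x)]
      fun p ↦ fderiv ℝ (coordMap m n φ x (φ x)) p (coframe x x e) := by
    have hN : (extChartAt (𝓡 n) (φ x)).source
        ∈ 𝓝 (φ ((extChartAt (𝓡 m) x).symm (extChartAt (𝓡 m) x x))) := by
      rw [extChartAt_to_inv]
      exact extChartAt_source_mem_nhds (φ x)
    filter_upwards [extChartAt_target_mem_nhds (I := 𝓡 m) x, hcont.eventually hN]
      with p hp hp2
    have hs := (extChartAt (𝓡 m) x).map_target hp
    simp only [Function.comp_apply, localRep, pushField]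
    rw [trivialization_snd hp2, coframe_mfderiv hφ.contMDiffAt hs hp2, constField_eq hs, coframe_frame hs,
      (extChartAt (𝓡 m) x).right_inv hp]
  have hdd : DifferentiableAt ℝ (fderiv ℝ (coordMap m n φ x (φ x))) (extChartAt (𝓡 m) x x) :=
    (hc.fderiv_right (m := ∞) (by simp)).differentiableAt (by simp)
  have h2 := (hdd.hasFDerivAt.clm_apply
    (hasFDerivAt_const (coframe x x e) _)).congr_of_eventuallyEq h1
  rw [coframe_covAlong hφ.contMDiffAt _ _ h2.differentiableAt, h2.fderiv, pushField, constField_eq hx,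
    frame_coframe hx, coframe_mfderiv hφ.contMDiffAt hx hy]
  simp

theorem coframe_nabla_constField {y : N} (e v : TangentSpace (𝓡 n) y) :
    coframe y y (nabla (constField e) y v)
      = chr (metricCoord y) (extChartAt (𝓡 n) y y) (coframe y y v) (coframe y y e) := by
  have hy := mem_extChartAt_source (I := 𝓡 n) y
  have h1 : (localRep (id : N → N) (constField e) y ∘ (extChartAt (𝓡 n) y).symm)
      =ᶠ[𝓝 (extChartAt (𝓡 n) y y)] fun p ↦ coframe y y e := by
    filter_upwards [extChartAt_target_mem_nhds (I := 𝓡 n) y] with p hp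
    have hs := (extChartAt (𝓡 n) y).map_target hp
    simp only [Function.comp_apply, localRep, id]
    rw [trivialization_snd hs, constField_eq hs, coframe_frame hs]
  have h2 := (hasFDerivAt_const (𝕜 := ℝ) (coframe y y e) _).congr_of_eventuallyEq h1
  have h3 := coframe_covAlong (φ := (id : N → N)) (x := y) contMDiffAt_id (constField e) v
    h2.differentiableAt
  have h4 := coframe_mfderiv (φ := (id : N → N)) (x := y) contMDiffAt_id hy hy v
  rw [mfderiv_id] at h4
  rw [nabla]
  refine h3.trans ?_
  rw [h2.fderiv]
  simp only [id]
  simp only [id] at h4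
  rw [← h4, constField_eq hy, frame_coframe hy]
  simp

end Christoffel

/-! ### The tension field in arbitrary charts -/

section Tension

variable {m n : ℕ}
  {M : Type*} [TopologicalSpace M] [ChartedSpace (EuclideanSpace ℝ (Fin m)) M]
  [IsManifold (𝓡 m) ∞ M] [RiemannianBundle (fun x : M ↦ TangentSpace (𝓡 m) x)]
  [IsContMDiffRiemannianBundle (𝓡 m) ∞ (EuclideanSpace ℝ (Fin m))
      (fun x : M ↦ TangentSpace (𝓡 m) x)]
  {N : Type*} [TopologicalSpace N] [ChartedSpace (EuclideanSpace ℝ (Fin n)) N]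
  [IsManifold (𝓡 n) ∞ N] [RiemannianBundle (fun y : N ↦ TangentSpace (𝓡 n) y)]
  [IsContMDiffRiemannianBundle (𝓡 n) ∞ (EuclideanSpace ℝ (Fin n))
      (fun y : N ↦ TangentSpace (𝓡 n) y)]

variable (m n) in
/-- The covariant Hessian of `φ` in the preferred charts at `x₀` and `y₀`. -/
def hessCoord (φ : M → N) (x₀ : M) (y₀ : N) (p : EuclideanSpace ℝ (Fin m)) :
    EuclideanSpace ℝ (Fin m) →L[ℝ] EuclideanSpace ℝ (Fin m) →L[ℝ] EuclideanSpace ℝ (Fin n) :=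
  hess (metricCoord x₀) (metricCoord y₀) (coordMap m n φ x₀ y₀) p

theorem coframe_secondDerivative {φ : M → N} {x : M} (hφ : ContMDiff (𝓡 m) (𝓡 n) ∞ φ)
    (e v : TangentSpace (𝓡 m) x) :
    coframe (φ x) (φ x) (covAlong φ (pushField m n φ (constField e)) x v
        - mfderiv (𝓡 m) (𝓡 n) φ x (nabla (constField e) x v))
      = hessCoord m n φ x (φ x) (extChartAt (𝓡 m) x x) (coframe x x v) (coframe x x e) := by
  have hx := mem_extChartAt_source (I := 𝓡 m) x
  have hy := mem_extChartAt_source (I := 𝓡 n) (φ x)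
  rw [map_sub, coframe_covAlong_pushField hφ, coframe_mfderiv hφ.contMDiffAt hx hy, coframe_nabla_constField,
    hessCoord, hess_apply, coordMap_extChartAt _ _ hx]

theorem coframe_tension_self {φ : M → N} {x : M} (hφ : ContMDiff (𝓡 m) (𝓡 n) ∞ φ) :
    coframe (φ x) (φ x) (tension m n φ x)
      = ∑ i, hessCoord m n φ x (φ x) (extChartAt (𝓡 m) x x) (coframe x x (onb m x i))
          (coframe x x (onb m x i)) := by
  rw [tension, map_sum]
  exact Finset.sum_congr rfl fun i _ ↦ coframe_secondDerivative hφ _ _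

omit [IsContMDiffRiemannianBundle (𝓡 m) ∞ (EuclideanSpace ℝ (Fin m))
      (fun x : M ↦ TangentSpace (𝓡 m) x)]
    [IsContMDiffRiemannianBundle (𝓡 n) ∞ (EuclideanSpace ℝ (Fin n))
      (fun y : N ↦ TangentSpace (𝓡 n) y)] in
/-- Coordinate representations of isometric maps pull back the metric. -/
theorem metricCoord_pullback {φ : M → N} {x₀ x : M} {y₀ : N}
    (hφ : ContMDiffAt (𝓡 m) (𝓡 n) ∞ φ x)
    (hiso : ∀ u v : TangentSpace (𝓡 m) x,
      inner ℝ (mfderiv (𝓡 m) (𝓡 n) φ x u) (mfderiv (𝓡 m) (𝓡 n) φ x v) = (inner ℝ u v : ℝ))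
    (hx : x ∈ (extChartAt (𝓡 m) x₀).source) (hy : φ x ∈ (extChartAt (𝓡 n) y₀).source)
    (u w : EuclideanSpace ℝ (Fin m)) :
    metricCoord x₀ (extChartAt (𝓡 m) x₀ x) u w
      = metricCoord y₀ (coordMap m n φ x₀ y₀ (extChartAt (𝓡 m) x₀ x))
          (fderiv ℝ (coordMap m n φ x₀ y₀) (extChartAt (𝓡 m) x₀ x) u)
          (fderiv ℝ (coordMap m n φ x₀ y₀) (extChartAt (𝓡 m) x₀ x) w) := by
  have h := coframe_mfderiv hφ hx hy
  rw [metricCoord_extChartAt hx, ← hiso, coordMap_extChartAt _ _ hx, ← metricCoord_coframe hy,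
    h, h, coframe_frame hx, coframe_frame hx]

omit [IsContMDiffRiemannianBundle (𝓡 m) ∞ (EuclideanSpace ℝ (Fin m))
      (fun x : M ↦ TangentSpace (𝓡 m) x)] in
/-- The covariant Hessian of an isometric map is normal. -/
theorem hessCoord_normal {φ : M → N} (hφ : ContMDiff (𝓡 m) (𝓡 n) ∞ φ) {x₀ x : M} {y₀ : N}
    (hiso : ∀ (x : M) (u v : TangentSpace (𝓡 m) x),
      inner ℝ (mfderiv (𝓡 m) (𝓡 n) φ x u) (mfderiv (𝓡 m) (𝓡 n) φ x v) = (inner ℝ u v : ℝ))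
    (hx : x ∈ (extChartAt (𝓡 m) x₀).source) (hy : φ x ∈ (extChartAt (𝓡 n) y₀).source)
    (u w e : EuclideanSpace ℝ (Fin m)) :
    metricCoord y₀ (extChartAt (𝓡 n) y₀ (φ x))
      (hessCoord m n φ x₀ y₀ (extChartAt (𝓡 m) x₀ x) u w)
      (fderiv ℝ (coordMap m n φ x₀ y₀) (extChartAt (𝓡 m) x₀ x) e) = 0 := by
  have hxt := (extChartAt (𝓡 m) x₀).map_source hx
  have hyt := (extChartAt (𝓡 n) y₀).map_source hy
  have hinv := (extChartAt (𝓡 m) x₀).left_inv hx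
  rw [← coordMap_extChartAt (m := m) φ y₀ hx] at hyt ⊢
  refine hess_normal ((contDiffAt_coordMap hφ.contMDiffAt hx hy).of_le ENat.LEInfty.out)
    ((contDiffAt_metricCoord hyt).differentiableAt (by simp))
    (Eventually.of_forall fun q ↦ metricCoord_symm y₀ q)
    (metricCoord_isInvertible hxt) (metricCoord_isInvertible hyt) ?_ u w e
  have hcont : ContinuousAt (fun p ↦ φ ((extChartAt (𝓡 m) x₀).symm p))
      (extChartAt (𝓡 m) x₀ x) :=
    ContinuousAt.comp (g := φ) hφ.continuous.continuousAt (continuousAt_extChartAt_symm' hx)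
  have hN : (extChartAt (𝓡 n) y₀).source
      ∈ 𝓝 (φ ((extChartAt (𝓡 m) x₀).symm (extChartAt (𝓡 m) x₀ x))) := by
    rw [hinv]
    exact extChartAt_source_mem_nhds' hy
  filter_upwards [extChartAt_target_mem_nhds' (I := 𝓡 m) hxt, hcont.eventually hN] with p hp hp2
  have hs := (extChartAt (𝓡 m) x₀).map_target hp
  have := metricCoord_pullback hφ.contMDiffAt (hiso _) hs hp2
  rwa [(extChartAt (𝓡 m) x₀).right_inv hp] at this

omit [RiemannianBundle (fun x : M ↦ TangentSpace (𝓡 m) x)]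
    [IsContMDiffRiemannianBundle (𝓡 m) ∞ (EuclideanSpace ℝ (Fin m))
      (fun x : M ↦ TangentSpace (𝓡 m) x)] in
theorem coframe_change {x₀ x₁ x : M} (hx : x ∈ (extChartAt (𝓡 m) x₀).source)
    (hx' : x ∈ (extChartAt (𝓡 m) x₁).source) (u : TangentSpace (𝓡 m) x) :
    fderiv ℝ (coordMap m m (id : M → M) x₀ x₁) (extChartAt (𝓡 m) x₀ x) (coframe x₀ x u)
      = coframe x₁ x u := by
  have h4 := coframe_mfderiv (φ := (id : M → M)) (x := x) contMDiffAt_id hx hx' u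
  rw [mfderiv_id] at h4
  exact h4.symm

/-- The transition map is an isometry between the two coordinate metrics, so its Hessian is
orthogonal to the image of its derivative. That derivative is onto, hence the Hessian vanishes; this
is the transformation law of Christoffel symbols. -/
theorem hessCoord_id {x₀ x₁ x : M} (hx : x ∈ (extChartAt (𝓡 m) x₀).source)
    (hx' : x ∈ (extChartAt (𝓡 m) x₁).source) :
    hessCoord m m (id : M → M) x₀ x₁ (extChartAt (𝓡 m) x₀ x) = 0 := by
  have hiso : ∀ (x : M) (u v : TangentSpace (𝓡 m) x),
      inner ℝ (mfderiv (𝓡 m) (𝓡 m) (id : M → M) x u) (mfderiv (𝓡 m) (𝓡 m) (id : M → M) x v)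
        = (inner ℝ u v : ℝ) := by
    intro x u v
    rw [mfderiv_id]
    rfl
  ext1 u
  ext1 w
  refine (metricCoord_isInvertible ((extChartAt (𝓡 m) x₁).map_source hx')).injective ?_
  rw [_root_.zero_apply, _root_.zero_apply, map_zero]
  ext1 e
  have h := hessCoord_normal (φ := (id : M → M)) contMDiff_id hiso hx hx' u w
    (coframe x₀ x (frame x₁ x e))
  rw [coframe_change hx hx', coframe_frame hx'] at h
  exact h

/-- The tension field in arbitrary preferred charts. -/
theorem coframe_tension {φ : M → N} (hφ : ContMDiff (𝓡 m) (𝓡 n) ∞ φ) {x₀ x : M} {y₀ : N}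
    (hx : x ∈ (extChartAt (𝓡 m) x₀).source) (hy : φ x ∈ (extChartAt (𝓡 n) y₀).source) :
    coframe y₀ (φ x) (tension m n φ x)
      = traceForm (metricCoord x₀ (extChartAt (𝓡 m) x₀ x))
          (hessCoord m n φ x₀ y₀ (extChartAt (𝓡 m) x₀ x)) := by
  have hx1 := mem_extChartAt_source (I := 𝓡 m) x
  have hy1 := mem_extChartAt_source (I := 𝓡 n) (φ x)
  have hθ : coordMap m m (id : M → M) x x₀ (extChartAt (𝓡 m) x x) = extChartAt (𝓡 m) x₀ x :=
    coordMap_extChartAt _ _ hx1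
  have hψ : coordMap m n φ x (φ x) (extChartAt (𝓡 m) x x) = extChartAt (𝓡 n) (φ x) (φ x) :=
    coordMap_extChartAt _ _ hx1
  have hcont : ContinuousAt (fun p ↦ φ ((extChartAt (𝓡 m) x).symm p)) (extChartAt (𝓡 m) x x) :=
    ContinuousAt.comp (g := φ) hφ.continuous.continuousAt (continuousAt_extChartAt_symm x)
  have hN : (extChartAt (𝓡 n) (φ x)).source
      ∈ 𝓝 (φ ((extChartAt (𝓡 m) x).symm (extChartAt (𝓡 m) x x))) := by
    rw [extChartAt_to_inv]
    exact extChartAt_source_mem_nhds (φ x)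
  have hM : (extChartAt (𝓡 m) x₀).source
      ∈ 𝓝 ((extChartAt (𝓡 m) x).symm (extChartAt (𝓡 m) x x)) := by
    rw [extChartAt_to_inv]
    exact extChartAt_source_mem_nhds' hx
  have hcomm : coordMap n n (id : N → N) (φ x) y₀ ∘ coordMap m n φ x (φ x)
      =ᶠ[𝓝 (extChartAt (𝓡 m) x x)] coordMap m n φ x₀ y₀ ∘ coordMap m m (id : M → M) x x₀ := by
    filter_upwards [(continuousAt_extChartAt_symm x).eventually hM, hcont.eventually hN]
      with p hp hp2
    simp only [coordMap, Function.comp_apply, id, (extChartAt (𝓡 n) (φ x)).left_inv hp2,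
      (extChartAt (𝓡 m) x₀).left_inv hp]
  -- `tension` at `x` is defined in charts centred at `x` and `φ x`. Since transition maps have zero
  -- Hessian, naturality carries `∇dφ` to the fixed charts at `x₀` and `y₀`.
  have hnat : ∀ u w, fderiv ℝ (coordMap n n (id : N → N) (φ x) y₀) (extChartAt (𝓡 n) (φ x) (φ x))
      (hessCoord m n φ x (φ x) (extChartAt (𝓡 m) x x) u w)
      = hessCoord m n φ x₀ y₀ (extChartAt (𝓡 m) x₀ x)
          (fderiv ℝ (coordMap m m (id : M → M) x x₀) (extChartAt (𝓡 m) x x) u)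
          (fderiv ℝ (coordMap m m (id : M → M) x x₀) (extChartAt (𝓡 m) x x) w) := by
    intro u w
    have h := hess_natural (G := metricCoord x) (H := metricCoord (φ x)) (G' := metricCoord x₀)
      (H' := metricCoord y₀) (ψ := coordMap m n φ x (φ x)) (ψ' := coordMap m n φ x₀ y₀)
      (θ := coordMap m m (id : M → M) x x₀) (κ := coordMap n n (id : N → N) (φ x) y₀)
      (p := extChartAt (𝓡 m) x x)
      ((contDiffAt_coordMap hφ.contMDiffAt hx1 hy1).of_le ENat.LEInfty.out)
      (by rw [hθ]; exact (contDiffAt_coordMap hφ.contMDiffAt hx hy).of_le ENat.LEInfty.out)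
      ((contDiffAt_coordMap contMDiffAt_id hx1 hx).of_le ENat.LEInfty.out)
      (by rw [hψ]; exact (contDiffAt_coordMap contMDiffAt_id hy1 hy).of_le ENat.LEInfty.out)
      (hessCoord_id hx1 hx) (by rw [hψ]; exact hessCoord_id hy1 hy) hcomm u w
    rw [hψ, hθ] at h
    exact h
  rw [← coframe_change hy1 hy, coframe_tension_self hφ, map_sum,
    traceForm_eq_sum (e := fun i ↦ coframe x₀ x (onb m x i))
      (metricCoord_isInvertible ((extChartAt (𝓡 m) x₀).map_source hx))]
  · refine Finset.sum_congr rfl fun i _ ↦ ?_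
    rw [hnat, coframe_change hx1 hx]
  · intro i j
    rw [metricCoord_coframe hx]
    exact orthonormal_iff_ite.mp (onb m x).orthonormal i j

end Tension

theorem eq_zero_of_coframe {m : ℕ} {M : Type*} [TopologicalSpace M]
    [ChartedSpace (EuclideanSpace ℝ (Fin m)) M] [IsManifold (𝓡 m) ∞ M] {x₀ x : M}
    (hx : x ∈ (extChartAt (𝓡 m) x₀).source) {u : TangentSpace (𝓡 m) x}
    (h : coframe x₀ x u = 0) : u = 0 := by
  rw [← frame_coframe hx u, h, map_zero]

/-! ### Vanishing of covariant derivatives and curvature -/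

section Vanishing

variable {m n : ℕ}
  {M : Type*} [TopologicalSpace M] [ChartedSpace (EuclideanSpace ℝ (Fin m)) M]
  [IsManifold (𝓡 m) ∞ M]
  {N : Type*} [TopologicalSpace N] [ChartedSpace (EuclideanSpace ℝ (Fin n)) N]
  [IsManifold (𝓡 n) ∞ N] [RiemannianBundle (fun y : N ↦ TangentSpace (𝓡 n) y)]
  [IsContMDiffRiemannianBundle (𝓡 n) ∞ (EuclideanSpace ℝ (Fin n))
      (fun y : N ↦ TangentSpace (𝓡 n) y)]

theorem covAlong_eq_zero {φ : M → N} {x : M} (hφ : ContMDiff (𝓡 m) (𝓡 n) ∞ φ)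
    {W : Π x : M, TangentSpace (𝓡 n) (φ x)} (hW : ∀ᶠ x' in 𝓝 x, W x' = 0)
    (v : TangentSpace (𝓡 m) x) : covAlong φ W x v = 0 := by
  have hy := mem_extChartAt_source (I := 𝓡 n) (φ x)
  have h0 : ∀ᶠ x' in 𝓝 x, localRep φ W x x' = 0 := by
    have := hφ.continuous.continuousAt.eventually (extChartAt_source_mem_nhds (I := 𝓡 n) (φ x))
    filter_upwards [hW, this] with x' h1 h2
    rw [localRep, trivialization_snd h2, h1, map_zero]
  have hc := continuousAt_extChartAt_symm (I := 𝓡 m) x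
  rw [ContinuousAt, extChartAt_to_inv] at hc
  have h1 : localRep φ W x ∘ (extChartAt (𝓡 m) x).symm =ᶠ[𝓝 (extChartAt (𝓡 m) x x)]
      fun _ ↦ (0 : EuclideanSpace ℝ (Fin n)) := by
    filter_upwards [hc.eventually h0] with p hp using hp
  have h2 := (hasFDerivAt_const (𝕜 := ℝ) (0 : EuclideanSpace ℝ (Fin n))
    (extChartAt (𝓡 m) x x)).congr_of_eventuallyEq h1
  apply eq_zero_of_coframe hy
  rw [coframe_covAlong hφ.contMDiffAt _ _ h2.differentiableAt, h2.fderiv, hW.self_of_nhds]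
  simp

-- Both summands are linear in the direction, whatever the regularity of `φ` and `W`. The converse
-- for the `f`-bitension field can thus discard the gradient term without knowing that `tension` is
-- smooth.
omit [IsManifold (𝓡 m) ∞ M] in
theorem covAlong_zero_right (φ : M → N) (W : Π x : M, TangentSpace (𝓡 n) (φ x)) (x : M) :
    covAlong φ W x (0 : TangentSpace (𝓡 m) x) = 0 := by
  have hy := mem_extChartAt_source (I := 𝓡 n) (φ x)
  apply eq_zero_of_coframe hy
  rw [covAlong, map_add, coframe_christoffel, map_zero, map_zero, map_zero, map_zero, zero_apply,
    add_zero, ← Trivialization.symmL_apply (R := ℝ) _ (mem_baseSet hy), map_zero, map_zero]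

omit [RiemannianBundle (fun y : N ↦ TangentSpace (𝓡 n) y)]
  [IsContMDiffRiemannianBundle (𝓡 n) ∞ (EuclideanSpace ℝ (Fin n))
      (fun y : N ↦ TangentSpace (𝓡 n) y)] in
theorem constField_zero_eventually (y : N) :
    ∀ᶠ z in 𝓝 y, constField (0 : TangentSpace (𝓡 n) y) z = 0 := by
  filter_upwards [extChartAt_source_mem_nhds (I := 𝓡 n) y] with z hz
  rw [constField_eq hz, map_zero, map_zero]

/-- The constant-component extension of zero vanishes near `y`, so all three terms of `curvature`
vanish separately and tensoriality is not invoked. -/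
theorem curvature_zero_middle (y : N) (u w : TangentSpace (𝓡 n) y) : curvature y u 0 w = 0 := by
  have h0 := constField_zero_eventually (n := n) y
  have h1 : nabla (fun z ↦ nabla (constField w) z (constField (0 : TangentSpace (𝓡 n) y) z)) y u
      = 0 := by
    refine covAlong_eq_zero (φ := (id : N → N)) contMDiff_id ?_ u
    filter_upwards [h0] with z hz
    rw [hz]
    exact covAlong_zero_right (m := n) (id : N → N) _ z
  have h2 : VectorField.mlieBracket (𝓡 n) (constField u)
      (constField (0 : TangentSpace (𝓡 n) y)) y = 0 := by
    have h3 : constField (0 : TangentSpace (𝓡 n) y) =ᶠ[𝓝 y] 0 := h0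
    refine (Filter.EventuallyEq.mlieBracket_vectorField_eq (I := 𝓡 n) (V := constField u)
      EventuallyEq.rfl h3).trans ?_
    exact congrFun (VectorField.mlieBracket_zero_right (I := 𝓡 n) (W := constField u)) y
  rw [curvature, h1, h2]
  have h4 : ∀ X : Π z : N, TangentSpace (𝓡 n) z, nabla X y 0 = 0 := fun X ↦
    covAlong_zero_right (m := n) (id : N → N) X y
  rw [h4, h4]
  simp

end Vanishing

/-! ### Minimality as vanishing tension -/

section Minimal

variable {m n : ℕ}
  {M : Type*} [TopologicalSpace M] [ChartedSpace (EuclideanSpace ℝ (Fin m)) M]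
  [IsManifold (𝓡 m) ∞ M] [RiemannianBundle (fun x : M ↦ TangentSpace (𝓡 m) x)]
  [IsContMDiffRiemannianBundle (𝓡 m) ∞ (EuclideanSpace ℝ (Fin m))
      (fun x : M ↦ TangentSpace (𝓡 m) x)]
  {N : Type*} [TopologicalSpace N] [ChartedSpace (EuclideanSpace ℝ (Fin n)) N]
  [IsManifold (𝓡 n) ∞ N] [RiemannianBundle (fun y : N ↦ TangentSpace (𝓡 n) y)]
  [IsContMDiffRiemannianBundle (𝓡 n) ∞ (EuclideanSpace ℝ (Fin n))
      (fun y : N ↦ TangentSpace (𝓡 n) y)]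

/-- The tension field of an isometric immersion is normal. -/
theorem tension_mem_normalSpace {φ : M → N} (hφ : IsIsometricImmersion m n φ) (x : M) :
    tension m n φ x ∈ normalSpace m n φ x := by
  have hx := mem_extChartAt_source (I := 𝓡 m) x
  have hy := mem_extChartAt_source (I := 𝓡 n) (φ x)
  rw [normalSpace, Submodule.mem_orthogonal]
  rintro _ ⟨u, rfl⟩
  rw [real_inner_comm]
  change inner ℝ (tension m n φ x) (mfderiv (𝓡 m) (𝓡 n) φ x u) = 0
  rw [← metricCoord_coframe hy, coframe_tension_self hφ.smooth,
    coframe_mfderiv hφ.smooth.contMDiffAt hx hy, map_sum, _root_.sum_apply]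
  exact Finset.sum_eq_zero fun i _ ↦ hessCoord_normal hφ.smooth hφ.isometric hx hy _ _ _

/-- The normal projection fixes `τ` and kills the tangential vectors `dφ(∇e_i e_i)`, by which the
summands of `τ` differ from those defining `B`. -/
theorem meanCurvature_eq_tension {φ : M → N} (hφ : IsIsometricImmersion m n φ) (x : M) :
    meanCurvature m n φ x = (m : ℝ)⁻¹ • tension m n φ x := by
  have h1 : (normalSpace m n φ x).starProjection (tension m n φ x) = tension m n φ x :=
    Submodule.starProjection_eq_self_iff.mpr (tension_mem_normalSpace hφ x)
  have h2 : ∀ u : TangentSpace (𝓡 m) x,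
      (normalSpace m n φ x).starProjection (mfderiv (𝓡 m) (𝓡 n) φ x u) = 0 := by
    intro u
    rw [Submodule.starProjection_apply_eq_zero_iff, normalSpace]
    exact Submodule.le_orthogonal_orthogonal _ ⟨u, rfl⟩
  rw [meanCurvature, ← h1, tension, map_sum]
  congr 1
  refine Finset.sum_congr rfl fun i _ ↦ ?_
  rw [map_sub, h2, sub_zero]
  rfl

/-- An isometric immersion is minimal if and only if its tension field vanishes. -/
theorem isMinimal_iff_tension {φ : M → N} (hφ : IsIsometricImmersion m n φ) :
    IsMinimal m n φ ↔ ∀ x, tension m n φ x = 0 := by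
  refine forall_congr' fun x ↦ ?_
  rw [meanCurvature_eq_tension hφ]
  -- For `m = 0` the factor `(0 : ℝ)⁻¹` is zero, but the tension is then an empty sum.
  rcases Nat.eq_zero_or_pos m with rfl | hm
  · simp [tension]
  · simp [hm.ne']

omit [IsContMDiffRiemannianBundle (𝓡 m) ∞ (EuclideanSpace ℝ (Fin m))
      (fun x : M ↦ TangentSpace (𝓡 m) x)] in
theorem fBitension_eq_zero {φ : M → N} (hφ : ContMDiff (𝓡 m) (𝓡 n) ∞ φ)
    (h : ∀ x, tension m n φ x = 0) (f : M → ℝ) (x : M) : fBitension m n φ f x = 0 := by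
  have h0 : ∀ z v, covAlong φ (tension m n φ) z v = 0 := fun z v ↦
    covAlong_eq_zero hφ (Eventually.of_forall h) v
  have h1 : bitension m n φ x = 0 := by
    rw [bitension, roughLaplacian, h x]
    simp only [curvature_zero_middle, h0, sub_zero, Finset.sum_const_zero]
    refine Finset.sum_eq_zero fun i _ ↦ ?_
    exact covAlong_eq_zero hφ (Eventually.of_forall fun z ↦ rfl) _
  rw [fBitension, h1, h x, h0]
  simp

end Minimal

/-! ### Quadratic bump functions, and the converse for the equation -/

section Bump

variable {m : ℕ} {M : Type*} [TopologicalSpace M] [T2Space M]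
  [ChartedSpace (EuclideanSpace ℝ (Fin m)) M] [IsManifold (𝓡 m) ∞ M]

/-- A nonnegative smooth function, supported near `x₀`, which agrees near `x₀` with the square of
the distance to `x₀` in the preferred chart. -/
theorem exists_quadratic_bump {x₀ : M} {U : Set M} (hU : U ∈ 𝓝 x₀) :
    ∃ (q : M → ℝ) (K : Set M), ContMDiff (𝓡 m) 𝓘(ℝ, ℝ) ∞ q ∧ (∀ x, 0 ≤ q x) ∧ IsCompact K ∧
      K ⊆ U ∧ K ∈ 𝓝 x₀ ∧ (∀ x ∉ K, q x = 0) ∧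
      q ∘ (extChartAt (𝓡 m) x₀).symm =ᶠ[𝓝 (extChartAt (𝓡 m) x₀ x₀)]
        fun p ↦ ‖p - extChartAt (𝓡 m) x₀ x₀‖ ^ 2 := by
  obtain ⟨χ, -, hχ⟩ := (SmoothBumpFunction.nhds_basis_tsupport (I := 𝓡 m) x₀).mem_iff.mp hU
  refine ⟨fun x ↦ χ x • ‖extChartAt (𝓡 m) x₀ x - extChartAt (𝓡 m) x₀ x₀‖ ^ 2, tsupport χ,
    χ.contMDiff_smul ?_, fun x ↦ mul_nonneg χ.nonneg (by positivity), χ.hasCompactSupport, hχ,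
    χ.tsupport_mem_nhds, fun x hx ↦ ?_, ?_⟩
  · have h1 : ContMDiffOn (𝓡 m) 𝓘(ℝ, EuclideanSpace ℝ (Fin m)) ∞ (extChartAt (𝓡 m) x₀)
        (chartAt (EuclideanSpace ℝ (Fin m)) x₀).source := contMDiffOn_extChartAt
    have h2 : ContDiff ℝ ∞ fun p ↦ ‖p - extChartAt (𝓡 m) x₀ x₀‖ ^ 2 :=
      (contDiff_id.sub contDiff_const).norm_sq ℝ
    exact h2.contMDiff.comp_contMDiffOn h1
  · simp [image_eq_zero_of_notMem_tsupport hx]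
  · have hc := continuousAt_extChartAt_symm (I := 𝓡 m) x₀
    rw [ContinuousAt, extChartAt_to_inv] at hc
    filter_upwards [hc.eventually χ.eventuallyEq_one, extChartAt_target_mem_nhds (I := 𝓡 m) x₀]
      with p hp hp2
    simp only [Function.comp_apply, hp, (extChartAt (𝓡 m) x₀).right_inv hp2]
    simp

end Bump

theorem hasFDerivAt_norm_sub_sq {E : Type*} [NormedAddCommGroup E] [InnerProductSpace ℝ E]
    (p₀ p : E) : HasFDerivAt (fun p ↦ ‖p - p₀‖ ^ 2) ((2 : ℝ) • innerSL ℝ (p - p₀)) p := by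
  have := ((hasFDerivAt_id p).sub_const p₀).norm_sq
  rw [ofNat_smul_eq_nsmul ℝ 2] at *
  exact this

section Laplacian

variable {m : ℕ} {M : Type*} [TopologicalSpace M]
  [ChartedSpace (EuclideanSpace ℝ (Fin m)) M] [IsManifold (𝓡 m) ∞ M]

theorem mvfderiv_quadratic {f : M → ℝ} {x₀ : M} {c : ℝ}
    (hf : f ∘ (extChartAt (𝓡 m) x₀).symm =ᶠ[𝓝 (extChartAt (𝓡 m) x₀ x₀)]
      fun p ↦ c + ‖p - extChartAt (𝓡 m) x₀ x₀‖ ^ 2) (u : TangentSpace (𝓡 m) x₀) :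
    mvfderiv (𝓡 m) f x₀ u = 0 := by
  have h := ((hasFDerivAt_norm_sub_sq (extChartAt (𝓡 m) x₀ x₀)
    (extChartAt (𝓡 m) x₀ x₀)).const_add c).congr_of_eventuallyEq hf
  rw [mvfderiv_eq_fderiv (mem_extChartAt_source x₀) h.differentiableAt, h.fderiv]
  simp

variable [RiemannianBundle (fun x : M ↦ TangentSpace (𝓡 m) x)]

/-- The differential vanishes at `x₀`, so the connection term drops out and the ordinary Hessian
`2⟨·,·⟩` is traced. The norm is the Euclidean one of the chart, so the value depends on the chart;
only its positivity is used. -/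
theorem laplacian_quadratic {f : M → ℝ} {x₀ : M} {c : ℝ}
    (hf : f ∘ (extChartAt (𝓡 m) x₀).symm =ᶠ[𝓝 (extChartAt (𝓡 m) x₀ x₀)]
      fun p ↦ c + ‖p - extChartAt (𝓡 m) x₀ x₀‖ ^ 2) :
    laplacian m f x₀ = ∑ i, 2 * ‖coframe x₀ x₀ (onb m x₀ i)‖ ^ 2 := by
  set p₀ := extChartAt (𝓡 m) x₀ x₀ with hp₀
  refine Finset.sum_congr rfl fun i _ ↦ ?_
  rw [mvfderiv_quadratic hf, sub_zero]
  set e := coframe x₀ x₀ (onb m x₀ i) with he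
  have h1 : (fun z ↦ mvfderiv (𝓡 m) f z (constField (onb m x₀ i) z)) ∘
      (extChartAt (𝓡 m) x₀).symm =ᶠ[𝓝 p₀] fun p ↦ 2 * inner ℝ (p - p₀) e := by
    filter_upwards [hf.eventually_nhds, extChartAt_target_mem_nhds (I := 𝓡 m) x₀] with p hp hp2
    have hs := (extChartAt (𝓡 m) x₀).map_target hp2
    have h := ((hasFDerivAt_norm_sub_sq p₀ p).const_add c).congr_of_eventuallyEq hp
    rw [← (extChartAt (𝓡 m) x₀).right_inv hp2] at h
    rw [Function.comp_apply, mvfderiv_eq_fderiv hs h.differentiableAt, h.fderiv,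
      constField_eq hs, coframe_frame hs, (extChartAt (𝓡 m) x₀).right_inv hp2]
    simp [he, inner_sub_left]
  have h2 : HasFDerivAt (fun p ↦ 2 * inner ℝ (p - p₀) e)
      ((2 : ℝ) • (innerSL ℝ).flip e) p₀ := by
    have h3 := (((innerSL ℝ).flip e).hasFDerivAt.comp p₀
      ((hasFDerivAt_id p₀).sub_const p₀)).const_smul (2 : ℝ)
    exact h3
  have h4 := h2.congr_of_eventuallyEq h1
  rw [mvfderiv_eq_fderiv (mem_extChartAt_source x₀) h4.differentiableAt, h4.fderiv]
  change 2 * inner ℝ e e = _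
  rw [real_inner_self_eq_norm_sq]

theorem sum_norm_coframe_pos (hm : m ≠ 0) (x₀ : M) :
    0 < ∑ i, 2 * ‖coframe x₀ x₀ (onb m x₀ i)‖ ^ 2 := by
  have : NeZero m := ⟨hm⟩
  refine Finset.sum_pos (fun i _ ↦ ?_) Finset.univ_nonempty
  have h : coframe x₀ x₀ (onb m x₀ i) ≠ 0 := fun h0 ↦
    (onb m x₀).orthonormal.ne_zero i (eq_zero_of_coframe (mem_extChartAt_source x₀) h0)
  positivity

end Laplacian

section Equation

variable {m n : ℕ}
  {M : Type*} [TopologicalSpace M] [T2Space M] [ChartedSpace (EuclideanSpace ℝ (Fin m)) M]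
  [IsManifold (𝓡 m) ∞ M] [RiemannianBundle (fun x : M ↦ TangentSpace (𝓡 m) x)]
  {N : Type*} [TopologicalSpace N] [ChartedSpace (EuclideanSpace ℝ (Fin n)) N]
  [IsManifold (𝓡 n) ∞ N] [RiemannianBundle (fun y : N ↦ TangentSpace (𝓡 n) y)]
  [IsContMDiffRiemannianBundle (𝓡 n) ∞ (EuclideanSpace ℝ (Fin n))
      (fun y : N ↦ TangentSpace (𝓡 n) y)]

/-- If the `f`-bitension field vanishes for all positive `f`, then so does the tension field. -/
theorem tension_eq_zero_of_fBitension {φ : M → N}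
    (h : ∀ f : M → ℝ, ContMDiff (𝓡 m) 𝓘(ℝ, ℝ) ∞ f → (∀ x, 0 < f x) →
      ∀ x, fBitension m n φ f x = 0) (x₀ : M) : tension m n φ x₀ = 0 := by
  rcases eq_or_ne m 0 with rfl | hm
  · simp [tension]
  -- The constant function `1` isolates the bitension field.
  have h1 : bitension m n φ x₀ = 0 := by
    have h2 := h (fun _ ↦ 1) contMDiff_const (fun _ ↦ one_pos) x₀
    have h3 : ∀ z, mvfderiv (𝓡 m) (fun _ : M ↦ (1 : ℝ)) z = 0 := fun z ↦ mvfderiv_const _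
    have h4 : laplacian m (fun _ : M ↦ (1 : ℝ)) x₀ = 0 := by
      simp [laplacian, h3, mvfderiv_const]
    have h5 : grad m (fun _ : M ↦ (1 : ℝ)) x₀ = 0 := by simp [grad, h3]
    rw [fBitension, h4, h5, covAlong_zero_right] at h2
    simpa using h2
  obtain ⟨q, -, hq, hq0, -, -, -, -, hquad⟩ := exists_quadratic_bump (m := m) (x₀ := x₀) univ_mem
  have hf : (fun x ↦ 1 + q x) ∘ (extChartAt (𝓡 m) x₀).symm =ᶠ[𝓝 (extChartAt (𝓡 m) x₀ x₀)]
      fun p ↦ 1 + ‖p - extChartAt (𝓡 m) x₀ x₀‖ ^ 2 := by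
    filter_upwards [hquad] with p hp
    rw [← hp]
    rfl
  -- Since `grad f` vanishes at `x₀` and the bitension term is gone, what remains is `Δf(x₀) • τ(x₀)
  -- = 0`.
  have h2 := h (fun x ↦ 1 + q x) (contMDiff_const.add hq)
    (fun x ↦ add_pos_of_pos_of_nonneg one_pos (hq0 x)) x₀
  have h5 : grad m (fun x ↦ 1 + q x) x₀ = 0 := by simp [grad, mvfderiv_quadratic hf]
  rw [fBitension, h1, h5, covAlong_zero_right, laplacian_quadratic hf] at h2
  simp only [smul_zero, zero_add, add_zero, smul_eq_zero] at h2
  exact h2.resolve_left (sum_norm_coframe_pos hm x₀).ne'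

end Equation

/-! ### Finiteness on compact sets and positivity on open sets of the Riemannian volume -/

section Volume

variable {m : ℕ} {M : Type*} [TopologicalSpace M]
  [ChartedSpace (EuclideanSpace ℝ (Fin m)) M]

theorem exists_isCompactChartCover [SecondCountableTopology M] [Nonempty M] :
    ∃ p : ℕ → M × Set M, IsCompactChartCover m M p := by
  have : LocallyCompactSpace M := ChartedSpace.locallyCompactSpace (EuclideanSpace ℝ (Fin m)) M
  have h1 : ∀ x : M, ∃ K, IsCompact K ∧ x ∈ interior K ∧
      K ⊆ (chartAt (EuclideanSpace ℝ (Fin m)) x).source := fun x ↦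
    exists_compact_subset (chartAt (EuclideanSpace ℝ (Fin m)) x).open_source
      (mem_chart_source _ x)
  choose K hK hxK hKs using h1
  obtain ⟨s, hs, hsu⟩ := TopologicalSpace.countable_cover_nhds
    (f := fun x ↦ interior (K x)) fun x ↦ isOpen_interior.mem_nhds (hxK x)
  have hne : s.Nonempty := by
    by_contra h
    rw [Set.not_nonempty_iff_eq_empty] at h
    obtain ⟨x⟩ := ‹Nonempty M›
    have : x ∈ ⋃ x ∈ s, interior (K x) := hsu ▸ mem_univ x
    simp [h] at this
  obtain ⟨c, rfl⟩ := hs.exists_eq_range hne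
  refine ⟨fun k ↦ (c k, K (c k)), fun k ↦ ⟨hK _, hKs _⟩, ?_⟩
  rw [← hsu, biUnion_range]

variable [IsManifold (𝓡 m) ∞ M] [RiemannianBundle (fun x : M ↦ TangentSpace (𝓡 m) x)]

/-- The density of the Riemannian measure in the preferred chart at `x₀`. -/
def chartDensity (x₀ y : M) : ℝ :=
  Real.sqrt (Matrix.of fun i j : Fin m ↦
    (inner ℝ (constField (y := x₀) (EuclideanSpace.single i (1 : ℝ)) y)
      (constField (y := x₀) (EuclideanSpace.single j (1 : ℝ)) y) : ℝ)).det

/-- The density is the square root of a Gram determinant, and the coordinate fields stay linearly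
independent throughout the chart domain. -/
theorem chartDensity_pos {x₀ y : M} (hy : y ∈ (extChartAt (𝓡 m) x₀).source) :
    0 < chartDensity (m := m) x₀ y := by
  have hx := mem_extChartAt_source (I := 𝓡 m) x₀
  have hinj : Function.Injective ((frame (n := m) x₀ y).comp (coframe x₀ x₀)) := by
    intro u w huw
    have h1 := congrArg (coframe x₀ y) huw
    rw [ContinuousLinearMap.comp_apply, ContinuousLinearMap.comp_apply, coframe_frame hy,
      coframe_frame hy] at h1
    rw [← frame_coframe hx u, h1, frame_coframe hx]
  have hb : LinearIndependent ℝ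
      fun i : Fin m ↦ (EuclideanSpace.single i (1 : ℝ) : TangentSpace (𝓡 m) x₀) := by
    have h1 := (EuclideanSpace.basisFun (Fin m) ℝ).toBasis.linearIndependent
    have h2 : ((EuclideanSpace.basisFun (Fin m) ℝ).toBasis : Fin m → EuclideanSpace ℝ (Fin m))
        = fun i ↦ EuclideanSpace.single i (1 : ℝ) := by
      ext1 i
      simp
    rw [h2] at h1
    exact h1
  have hli : LinearIndependent ℝ
      fun i : Fin m ↦ constField (y := x₀) (EuclideanSpace.single i (1 : ℝ)) y := by
    have h1 := hb.map' ((frame x₀ y).comp (coframe x₀ x₀)).toLinearMap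
      (LinearMap.ker_eq_bot.mpr hinj)
    have h2 : (fun i : Fin m ↦ constField (y := x₀) (EuclideanSpace.single i (1 : ℝ)) y)
        = ((frame x₀ y).comp (coframe x₀ x₀)).toLinearMap ∘
          fun i : Fin m ↦ (EuclideanSpace.single i (1 : ℝ) : TangentSpace (𝓡 m) x₀) :=
      funext fun i ↦ constField_eq hy _
    rw [h2]
    exact h1
  exact Real.sqrt_pos.mpr (Matrix.posDef_gram_of_linearIndependent hli).det_pos

variable [IsContMDiffRiemannianBundle (𝓡 m) ∞ (EuclideanSpace ℝ (Fin m))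
      (fun x : M ↦ TangentSpace (𝓡 m) x)]

theorem continuousOn_chartDensity (x₀ : M) :
    ContinuousOn (chartDensity (m := m) x₀) (extChartAt (𝓡 m) x₀).source := by
  refine ContinuousOn.sqrt ?_
  refine ContinuousOn.comp (g := Matrix.det) (t := univ) ?_ ?_ (mapsTo_univ _ _)
  · exact (Continuous.matrix_det continuous_id).continuousOn
  refine continuousOn_pi.mpr fun i ↦ continuousOn_pi.mpr fun j ↦ fun y hy ↦ ?_
  refine ContinuousWithinAt.congr
    (contMDiffAt_inner_frame hy (coframe x₀ x₀ (EuclideanSpace.single i (1 : ℝ)))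
      (coframe x₀ x₀ (EuclideanSpace.single j (1 : ℝ)))).continuousAt.continuousWithinAt
    (fun z hz ↦ congrArg₂ (inner ℝ) (constField_eq hz _) (constField_eq hz _))
    (congrArg₂ (inner ℝ) (constField_eq hy _) (constField_eq hy _))

variable [MeasurableSpace M] [BorelSpace M]

omit [IsManifold (𝓡 m) ∞ M] [RiemannianBundle (fun x : M ↦ TangentSpace (𝓡 m) x)]
  [IsContMDiffRiemannianBundle (𝓡 m) ∞ (EuclideanSpace ℝ (Fin m))
      (fun x : M ↦ TangentSpace (𝓡 m) x)] in
theorem map_chart_apply (x₀ : M) {S : Set M} (hS : MeasurableSet S) :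
    (volume.restrict (chartAt (EuclideanSpace ℝ (Fin m)) x₀).target).map
      (chartAt (EuclideanSpace ℝ (Fin m)) x₀).symm S
      = volume ((chartAt (EuclideanSpace ℝ (Fin m)) x₀).target ∩
        (chartAt (EuclideanSpace ℝ (Fin m)) x₀).symm ⁻¹' S) := by
  have hm := (chartAt (EuclideanSpace ℝ (Fin m)) x₀).open_target.measurableSet
  rw [Measure.map_apply_of_aemeasurable
    ((chartAt (EuclideanSpace ℝ (Fin m)) x₀).continuousOn_symm.aemeasurable hm) hS,
    Measure.restrict_apply' hm, inter_comm]

omit [BorelSpace M] [IsContMDiffRiemannianBundle (𝓡 m) ∞ (EuclideanSpace ℝ (Fin m))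
      (fun x : M ↦ TangentSpace (𝓡 m) x)] in
theorem chartVolume_apply (x₀ : M) {S : Set M} (hS : MeasurableSet S) :
    chartVolume m x₀ S = ∫⁻ y in S, ENNReal.ofReal (chartDensity (m := m) x₀ y)
      ∂((volume.restrict (chartAt (EuclideanSpace ℝ (Fin m)) x₀).target).map
      (chartAt (EuclideanSpace ℝ (Fin m)) x₀).symm) :=
  withDensity_apply _ hS

theorem chartVolume_lt_top [T2Space M] {x₀ : M} {S : Set M} (hS : IsCompact S)
    (hSs : S ⊆ (chartAt (EuclideanSpace ℝ (Fin m)) x₀).source) : chartVolume m x₀ S < ⊤ := by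
  obtain ⟨C, hC⟩ := hS.exists_bound_of_continuousOn
    ((continuousOn_chartDensity (m := m) x₀).mono (by simpa using hSs))
  rw [chartVolume_apply x₀ hS.measurableSet]
  refine setLIntegral_lt_top_of_le_nnreal ?_ ⟨C.toNNReal, fun y hy ↦ ?_⟩
  · rw [map_chart_apply x₀ hS.measurableSet]
    refine ne_of_lt ?_
    have : (chartAt (EuclideanSpace ℝ (Fin m)) x₀).target ∩
        (chartAt (EuclideanSpace ℝ (Fin m)) x₀).symm ⁻¹' S
        = chartAt (EuclideanSpace ℝ (Fin m)) x₀ '' S :=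
      ((chartAt (EuclideanSpace ℝ (Fin m)) x₀).image_eq_target_inter_inv_preimage hSs).symm
    rw [this]
    exact (hS.image_of_continuousOn
      ((chartAt (EuclideanSpace ℝ (Fin m)) x₀).continuousOn.mono hSs)).measure_lt_top
  · exact ENNReal.ofReal_le_ofReal ((le_abs_self _).trans (hC y hy))

theorem chartVolume_pos {x₀ : M} {U : Set M} (hU : IsOpen U) (hne : U.Nonempty)
    (hUs : U ⊆ (chartAt (EuclideanSpace ℝ (Fin m)) x₀).source) : 0 < chartVolume m x₀ U := by
  obtain ⟨y, hy⟩ := hne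
  have hys : y ∈ (extChartAt (𝓡 m) x₀).source := by simpa using hUs hy
  have hd := chartDensity_pos hys
  have hca : ContinuousAt (chartDensity (m := m) x₀) y :=
    (continuousOn_chartDensity x₀).continuousAt (extChartAt_source_mem_nhds' hys)
  obtain ⟨V, hVsub, hVo, hyV⟩ := mem_nhds_iff.mp
    (inter_mem (hca.eventually (lt_mem_nhds (half_lt_self hd))) (hU.mem_nhds hy))
  refine lt_of_lt_of_le ?_ (measure_mono fun z hz ↦ (hVsub hz).2)
  rw [chartVolume_apply x₀ hVo.measurableSet]
  refine lt_of_lt_of_le ?_ (setLIntegral_mono' hVo.measurableSet fun z hz ↦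
    ENNReal.ofReal_le_ofReal (hVsub hz).1.le)
  rw [setLIntegral_const, map_chart_apply x₀ hVo.measurableSet]
  refine ENNReal.mul_pos (by simpa using hd) (IsOpen.measure_pos _ ?_ ?_).ne'
  · exact (chartAt (EuclideanSpace ℝ (Fin m)) x₀).symm.isOpen_inter_preimage hVo
  · refine ⟨chartAt (EuclideanSpace ℝ (Fin m)) x₀ y,
      (chartAt (EuclideanSpace ℝ (Fin m)) x₀).map_source (hUs hy), ?_⟩
    rw [mem_preimage, (chartAt (EuclideanSpace ℝ (Fin m)) x₀).left_inv (hUs hy)]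
    exact hyV

variable [T2Space M]

/-- Finitely many of the interiors cover `K`, so all disjointed pieces beyond the largest index used
miss `K`. Each remaining piece lies in a compact subset of a chart domain, which has finite chart
volume. -/
theorem riemannianVolume_lt_top {K : Set M} (hK : IsCompact K) :
    riemannianVolume m M K < ⊤ := by
  rw [riemannianVolume]
  split_ifs with h
  swap
  · simp
  obtain ⟨hc, hcover⟩ := h.choose_spec
  set p := h.choose
  obtain ⟨t, ht⟩ := hK.elim_finite_subcover (fun k ↦ interior (p k).2)
    (fun _ ↦ isOpen_interior) (by rw [hcover]; exact subset_univ K)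
  rw [Measure.sum_apply _ hK.measurableSet, tsum_eq_sum (s := Finset.range (t.sup id + 1))]
  · refine ENNReal.sum_lt_top.mpr fun k _ ↦ ?_
    rw [Measure.restrict_apply hK.measurableSet]
    refine lt_of_le_of_lt (measure_mono ?_) (chartVolume_lt_top (hc k).1 (hc k).2)
    exact inter_subset_right.trans (disjointed_subset (fun j ↦ (p j).2) k)
  · intro k hk
    rw [Measure.restrict_apply hK.measurableSet]
    have : K ∩ disjointed (fun j ↦ (p j).2) k = ∅ := by
      rw [disjointed_eq_inter_compl]
      refine eq_empty_of_forall_notMem fun x hx ↦ ?_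
      obtain ⟨j, hj, hxj⟩ := mem_iUnion₂.mp (ht hx.1)
      have hjk : j < k := by
        have h1 := Finset.le_sup (f := id) hj
        simp only [Finset.mem_range, not_lt, id] at hk h1
        omega
      exact mem_iInter₂.mp hx.2.2 j hjk (interior_subset hxj)
    rw [this, measure_empty]

/-- Let `k` be the first index for which `U` meets the interior of the `k`-th compact set. The
earlier sets are closed and contain no nonempty open part of `U`, so removing them in turn from that
intersection leaves a nonempty open set inside the `k`-th disjointed piece. -/
theorem riemannianVolume_pos [SecondCountableTopology M] {U : Set M} (hU : IsOpen U) (hne : U.Nonempty) :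
    0 < riemannianVolume m M U := by
  have : Nonempty M := hne.to_type
  have h := exists_isCompactChartCover (m := m) (M := M)
  rw [riemannianVolume, dif_pos h]
  obtain ⟨hc, hcover⟩ := h.choose_spec
  set p := h.choose
  have hex : ∃ k, (U ∩ interior (p k).2).Nonempty := by
    obtain ⟨x, hx⟩ := hne
    have : x ∈ ⋃ k, interior (p k).2 := hcover ▸ mem_univ x
    obtain ⟨k, hk⟩ := mem_iUnion.mp this
    exact ⟨k, x, hx, hk⟩
  classical
  set k := Nat.find hex
  have hk := Nat.find_spec hex
  have hlt : ∀ j < k, ¬ (U ∩ interior (p j).2).Nonempty := fun j hj ↦ Nat.find_min hex hj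
  have hV : ∀ l ≤ k, ∃ V ⊆ U ∩ interior (p k).2, IsOpen V ∧ V.Nonempty ∧
      ∀ j < l, Disjoint V (p j).2 := by
    intro l
    induction l with
    | zero => exact fun _ ↦ ⟨_, Subset.rfl, hU.inter isOpen_interior, hk, by simp⟩
    | succ l ih =>
      intro hl
      obtain ⟨V, hVs, hVo, hVn, hVd⟩ := ih (by omega)
      refine ⟨V \ (p l).2, sdiff_subset.trans hVs, hVo.sdiff (hc l).1.isClosed, ?_, fun j hj ↦ ?_⟩
      · by_contra hempty
        rw [not_nonempty_iff_eq_empty, sdiff_eq_empty] at hempty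
        obtain ⟨x, hx⟩ := hVn
        exact hlt l (by omega) ⟨x, (hVs hx).1, interior_maximal hempty hVo hx⟩
      · rcases Nat.lt_succ_iff_lt_or_eq.mp hj with hj | rfl
        · exact (hVd j hj).mono_left sdiff_subset
        · exact disjoint_sdiff_left
  obtain ⟨V, hVs, hVo, hVn, hVd⟩ := hV k le_rfl
  have hVD : V ⊆ disjointed (fun j ↦ (p j).2) k := by
    rw [disjointed_eq_inter_compl]
    refine fun x hx ↦ ⟨interior_subset (hVs hx).2, mem_iInter₂.mpr fun j hj hxj ↦ ?_⟩
    exact disjoint_left.mp (hVd j hj) hx hxj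
  calc 0 < chartVolume m (p k).1 V :=
        chartVolume_pos hVo hVn fun x hx ↦ (hc k).2 (interior_subset (hVs hx).2)
    _ = (chartVolume m (p k).1).restrict (disjointed (fun j ↦ (p j).2) k) V := by
        rw [Measure.restrict_apply hVo.measurableSet, inter_eq_left.mpr hVD]
    _ ≤ _ := Measure.le_sum (fun k ↦ (chartVolume m (p k).1).restrict
        (disjointed (fun j ↦ (p j).2) k)) k V
    _ ≤ _ := measure_mono fun x hx ↦ (hVs hx).1

end Volume

/-! ### Tension fields of smooth families of maps -/

section Families

variable {m n : ℕ}
  {M : Type*} [TopologicalSpace M] [ChartedSpace (EuclideanSpace ℝ (Fin m)) M]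
  [IsManifold (𝓡 m) ∞ M] [RiemannianBundle (fun x : M ↦ TangentSpace (𝓡 m) x)]
  [IsContMDiffRiemannianBundle (𝓡 m) ∞ (EuclideanSpace ℝ (Fin m))
      (fun x : M ↦ TangentSpace (𝓡 m) x)]
  {N : Type*} [TopologicalSpace N] [ChartedSpace (EuclideanSpace ℝ (Fin n)) N]
  [IsManifold (𝓡 n) ∞ N] [RiemannianBundle (fun y : N ↦ TangentSpace (𝓡 n) y)]
  [IsContMDiffRiemannianBundle (𝓡 n) ∞ (EuclideanSpace ℝ (Fin n))
      (fun y : N ↦ TangentSpace (𝓡 n) y)]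

variable {Φ : ℝ → M → N}

omit [IsManifold (𝓡 m) ∞ M] [RiemannianBundle (fun x : M ↦ TangentSpace (𝓡 m) x)]
  [IsContMDiffRiemannianBundle (𝓡 m) ∞ (EuclideanSpace ℝ (Fin m))
      (fun x : M ↦ TangentSpace (𝓡 m) x)]
  [IsManifold (𝓡 n) ∞ N] [RiemannianBundle (fun y : N ↦ TangentSpace (𝓡 n) y)]
  [IsContMDiffRiemannianBundle (𝓡 n) ∞ (EuclideanSpace ℝ (Fin n))
      (fun y : N ↦ TangentSpace (𝓡 n) y)] in
theorem contMDiff_slice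
    (hΦ : ContMDiff (𝓘(ℝ, ℝ).prod (𝓡 m)) (𝓡 n) ∞ (fun p : ℝ × M ↦ Φ p.1 p.2)) (t : ℝ) :
    ContMDiff (𝓡 m) (𝓡 n) ∞ (Φ t) :=
  hΦ.comp (contMDiff_const.prodMk contMDiff_id)

/-- The tension field of a smooth family of maps depends smoothly on parameter and point. -/
theorem exists_local_tension
    (hΦ : ContMDiff (𝓘(ℝ, ℝ).prod (𝓡 m)) (𝓡 n) ∞ (fun p : ℝ × M ↦ Φ p.1 p.2)) (t₀ : ℝ) (x₀ : M) :
    ∃ (T : ℝ × EuclideanSpace ℝ (Fin m) → EuclideanSpace ℝ (Fin n))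
      (H : ℝ × EuclideanSpace ℝ (Fin m) →
        EuclideanSpace ℝ (Fin n) →L[ℝ] EuclideanSpace ℝ (Fin n) →L[ℝ] ℝ),
      ContDiffAt ℝ ∞ T (t₀, extChartAt (𝓡 m) x₀ x₀) ∧
      ContDiffAt ℝ ∞ H (t₀, extChartAt (𝓡 m) x₀ x₀) ∧
      ∀ᶠ z : ℝ × M in 𝓝 (t₀, x₀),
        coframe (Φ t₀ x₀) (Φ z.1 z.2) (tension m n (Φ z.1) z.2)
          = T (z.1, extChartAt (𝓡 m) x₀ z.2) ∧
        ‖tension m n (Φ z.1) z.2‖ ^ 2 = H (z.1, extChartAt (𝓡 m) x₀ z.2)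
          (T (z.1, extChartAt (𝓡 m) x₀ z.2)) (T (z.1, extChartAt (𝓡 m) x₀ z.2)) := by
  set y₀ := Φ t₀ x₀ with hy₀
  set p₀ := extChartAt (𝓡 m) x₀ x₀ with hp₀
  have hx := mem_extChartAt_source (I := 𝓡 m) x₀
  have hpt : p₀ ∈ (extChartAt (𝓡 m) x₀).target := mem_extChartAt_target x₀
  have hyt : extChartAt (𝓡 n) y₀ y₀ ∈ (extChartAt (𝓡 n) y₀).target := mem_extChartAt_target y₀
  let Ψ : ℝ × EuclideanSpace ℝ (Fin m) → EuclideanSpace ℝ (Fin n) :=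
    fun z ↦ coordMap m n (Φ z.1) x₀ y₀ z.2
  have hΨ0 : Ψ (t₀, p₀) = extChartAt (𝓡 n) y₀ y₀ := coordMap_extChartAt _ _ hx
  have hΨ : ContDiffAt ℝ ∞ Ψ (t₀, p₀) := by
    rw [← contMDiffAt_iff_contDiffAt]
    have h1 : ContMDiffAt 𝓘(ℝ, EuclideanSpace ℝ (Fin m)) (𝓡 m) ∞ (extChartAt (𝓡 m) x₀).symm p₀ :=
      (contMDiffOn_extChartAt_symm x₀).contMDiffAt (extChartAt_target_mem_nhds x₀)
    have h2 : ContMDiffAt 𝓘(ℝ, ℝ × EuclideanSpace ℝ (Fin m)) (𝓘(ℝ, ℝ).prod (𝓡 m)) ∞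
        (fun z : ℝ × EuclideanSpace ℝ (Fin m) ↦ (z.1, (extChartAt (𝓡 m) x₀).symm z.2))
        (t₀, p₀) :=
      ContMDiffAt.prodMk (contDiff_fst.contMDiff.contMDiffAt)
        (ContMDiffAt.comp (I' := 𝓘(ℝ, EuclideanSpace ℝ (Fin m)))
          (g := (extChartAt (𝓡 m) x₀).symm) (t₀, p₀) h1 contDiff_snd.contMDiff.contMDiffAt)
    have h3 : ContMDiffAt (𝓡 n) 𝓘(ℝ, EuclideanSpace ℝ (Fin n)) ∞ (extChartAt (𝓡 n) y₀) y₀ :=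
      contMDiffAt_extChartAt
    have h4 := hΦ.contMDiffAt.comp (t₀, p₀) h2
    refine ContMDiffAt.comp_of_eq (I' := 𝓡 n) (g := extChartAt (𝓡 n) y₀) h3 h4 ?_
    simp only [Function.comp_apply, hp₀, extChartAt_to_inv, hy₀]
  have hG := contDiffAt_metricCoord hpt
  have hH : ContDiffAt ℝ ∞ (metricCoord y₀) (Ψ (t₀, p₀)) := by
    rw [hΨ0]
    exact contDiffAt_metricCoord hyt
  refine ⟨fun z ↦ traceForm (metricCoord x₀ z.2) (hess (metricCoord x₀) (metricCoord y₀)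
    (fun q ↦ Ψ (z.1, q)) z.2), fun z ↦ metricCoord y₀ (Ψ z),
    contDiffAt_traceForm_hess (z := (t₀, p₀)) hΨ hG (metricCoord_isInvertible hpt) hH
      (by rw [hΨ0]; exact metricCoord_isInvertible hyt),
    ContDiffAt.comp (g := metricCoord y₀) (t₀, p₀) hH hΨ, ?_⟩
  have e1 : ∀ᶠ z : ℝ × M in 𝓝 (t₀, x₀), z.2 ∈ (extChartAt (𝓡 m) x₀).source :=
    continuous_snd.continuousAt.eventually (extChartAt_source_mem_nhds (I := 𝓡 m) x₀)
  have e2 : ∀ᶠ z : ℝ × M in 𝓝 (t₀, x₀), Φ z.1 z.2 ∈ (extChartAt (𝓡 n) y₀).source :=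
    hΦ.continuous.continuousAt.eventually (extChartAt_source_mem_nhds (I := 𝓡 n) y₀)
  filter_upwards [e1, e2] with z hz1 hz2
  have h5 := coframe_tension (contMDiff_slice hΦ z.1) hz1 hz2
  refine ⟨h5, ?_⟩
  rw [← real_inner_self_eq_norm_sq, ← metricCoord_coframe hz2, h5,
    ← coordMap_extChartAt (m := m) (Φ z.1) y₀ hz1]
  rfl

omit [IsManifold (𝓡 m) ∞ M] [RiemannianBundle (fun x : M ↦ TangentSpace (𝓡 m) x)]
  [IsContMDiffRiemannianBundle (𝓡 m) ∞ (EuclideanSpace ℝ (Fin m))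
      (fun x : M ↦ TangentSpace (𝓡 m) x)] in
theorem tendsto_prod_chart (t₀ : ℝ) (x₀ : M) :
    Tendsto (fun z : ℝ × M ↦ (z.1, extChartAt (𝓡 m) x₀ z.2)) (𝓝 (t₀, x₀))
      (𝓝 (t₀, extChartAt (𝓡 m) x₀ x₀)) :=
  (continuousAt_fst.prodMk (ContinuousAt.comp (x := (t₀, x₀)) (g := extChartAt (𝓡 m) x₀)
    (continuousAt_extChartAt x₀) continuousAt_snd) :
    ContinuousAt (fun z : ℝ × M ↦ (z.1, extChartAt (𝓡 m) x₀ z.2)) (t₀, x₀))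

theorem continuous_normSq_tension
    (hΦ : ContMDiff (𝓘(ℝ, ℝ).prod (𝓡 m)) (𝓡 n) ∞ (fun p : ℝ × M ↦ Φ p.1 p.2)) :
    Continuous (fun z : ℝ × M ↦ ‖tension m n (Φ z.1) z.2‖ ^ 2) := by
  refine continuous_iff_continuousAt.mpr fun ⟨t₀, x₀⟩ ↦ ?_
  obtain ⟨T, H, hT, hH, hev⟩ := exists_local_tension hΦ t₀ x₀
  have h1 : ContinuousAt (fun z ↦ H z (T z) (T z)) (t₀, extChartAt (𝓡 m) x₀ x₀) :=
    ((hH.clm_apply hT).clm_apply hT).continuousAt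
  have h2 : ContinuousAt (fun z : ℝ × M ↦ (z.1, extChartAt (𝓡 m) x₀ z.2)) (t₀, x₀) :=
    tendsto_prod_chart t₀ x₀
  have h3 := ContinuousAt.comp (x := (t₀, x₀)) (g := fun z ↦ H z (T z) (T z)) h1 h2
  refine h3.congr ?_
  filter_upwards [hev] with z hz
  exact hz.2.symm

/-- If the tension field of `Φ 0` vanishes, then that of `Φ t` is `O(t)`, locally uniformly. -/
theorem eventually_normSq_tension_le
    (hΦ : ContMDiff (𝓘(ℝ, ℝ).prod (𝓡 m)) (𝓡 n) ∞ (fun p : ℝ × M ↦ Φ p.1 p.2))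
    (h0 : ∀ x, tension m n (Φ 0) x = 0) (x₀ : M) :
    ∃ C : ℝ, ∀ᶠ z : ℝ × M in 𝓝 ((0 : ℝ), x₀), ‖tension m n (Φ z.1) z.2‖ ^ 2 ≤ C * z.1 ^ 2 := by
  obtain ⟨T, H, hT, hH, hev⟩ := exists_local_tension hΦ 0 x₀
  obtain ⟨L, s, hs, hL⟩ := (hT.of_le (m := 1) (by simp)).exists_lipschitzOnWith
  have hb : ∀ᶠ z in 𝓝 ((0 : ℝ), extChartAt (𝓡 m) x₀ x₀),
      ‖H z‖ < ‖H (0, extChartAt (𝓡 m) x₀ x₀)‖ + 1 :=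
    hH.continuousAt.norm.eventually (gt_mem_nhds (lt_add_one _))
  have hz : Tendsto (fun z : ℝ × M ↦ ((0 : ℝ), z.2)) (𝓝 ((0 : ℝ), x₀)) (𝓝 ((0 : ℝ), x₀)) :=
    (continuousAt_const.prodMk continuousAt_snd :
      ContinuousAt (fun z : ℝ × M ↦ ((0 : ℝ), z.2)) (0, x₀))
  have hc := tendsto_prod_chart (m := m) 0 x₀
  refine ⟨(‖H (0, extChartAt (𝓡 m) x₀ x₀)‖ + 1) * (L * L), ?_⟩
  filter_upwards [hev, hz.eventually hev, hc.eventually hb, hc.eventually hs,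
    (hc.comp hz).eventually hs] with z h1 h2 h3 h4 h5
  -- `T` vanishes on the slice `t = 0`, so its Lipschitz bound in the `t` direction reads `‖T(t, p)‖
  -- ≤ L|t|`.
  have h6 : T (0, extChartAt (𝓡 m) x₀ z.2) = 0 := by
    rw [← h2.1]
    simp only [h0, map_zero]
  have h7 := hL.norm_sub_le h4 h5
  simp only [Function.comp_apply] at h7
  rw [h6, sub_zero] at h7
  have h8 : ‖((z.1, extChartAt (𝓡 m) x₀ z.2) - (0, extChartAt (𝓡 m) x₀ z.2) :
      ℝ × EuclideanSpace ℝ (Fin m))‖ = |z.1| := by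
    simp [Prod.norm_def]
  rw [h8] at h7
  rw [h1.2]
  set τ := T (z.1, extChartAt (𝓡 m) x₀ z.2)
  calc H (z.1, extChartAt (𝓡 m) x₀ z.2) τ τ
      ≤ ‖H (z.1, extChartAt (𝓡 m) x₀ z.2)‖ * ‖τ‖ * ‖τ‖ :=
        (le_abs_self _).trans ((H (z.1, extChartAt (𝓡 m) x₀ z.2)).le_opNorm₂ τ τ)
    _ ≤ (‖H (0, extChartAt (𝓡 m) x₀ x₀)‖ + 1) * (L * |z.1|) * (L * |z.1|) := by gcongr
    _ = _ := by rw [← sq_abs z.1]; ring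

/-- Strict differentiability at `(0, x₀)` gives the first-order expansion in `t` with one slope `a`
and an error uniform for `x` near `x₀`. This uniformity allows the estimate to be integrated against
a bump. -/
theorem exists_strict_derivative_normSq_tension
    (hΦ : ContMDiff (𝓘(ℝ, ℝ).prod (𝓡 m)) (𝓡 n) ∞ (fun p : ℝ × M ↦ Φ p.1 p.2)) (x₀ : M) :
    ∃ a : ℝ, HasDerivAt (fun t ↦ ‖tension m n (Φ t) x₀‖ ^ 2) a 0 ∧
      ∀ ε > 0, ∀ᶠ z : ℝ × M in 𝓝 ((0 : ℝ), x₀),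
        |‖tension m n (Φ z.1) z.2‖ ^ 2 - ‖tension m n (Φ 0) z.2‖ ^ 2 - z.1 * a| ≤ ε * |z.1| := by
  obtain ⟨T, H, hT, hH, hev⟩ := exists_local_tension hΦ 0 x₀
  have hg : ContDiffAt ℝ ∞ (fun z ↦ H z (T z) (T z)) (0, extChartAt (𝓡 m) x₀ x₀) :=
    (hH.clm_apply hT).clm_apply hT
  obtain ⟨D, hD⟩ : ∃ D, HasStrictFDerivAt (fun z ↦ H z (T z) (T z)) D
      ((0 : ℝ), extChartAt (𝓡 m) x₀ x₀) := ⟨_, hg.hasStrictFDerivAt (by simp)⟩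
  have hz : Tendsto (fun z : ℝ × M ↦ ((0 : ℝ), z.2)) (𝓝 ((0 : ℝ), x₀)) (𝓝 ((0 : ℝ), x₀)) :=
    (continuousAt_const.prodMk continuousAt_snd :
      ContinuousAt (fun z : ℝ × M ↦ ((0 : ℝ), z.2)) (0, x₀))
  have hc := tendsto_prod_chart (m := m) 0 x₀
  have key : ∀ ε > 0, ∀ᶠ z : ℝ × M in 𝓝 ((0 : ℝ), x₀),
      |‖tension m n (Φ z.1) z.2‖ ^ 2 - ‖tension m n (Φ 0) z.2‖ ^ 2 - z.1 * D (1, 0)|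
        ≤ ε * |z.1| := by
    intro ε hε
    have h1 := (hasStrictFDerivAt_iff_isLittleO.mp hD).def hε
    have h2 : Tendsto (fun z : ℝ × M ↦ ((z.1, extChartAt (𝓡 m) x₀ z.2),
        ((0 : ℝ), extChartAt (𝓡 m) x₀ z.2))) (𝓝 ((0 : ℝ), x₀))
        (𝓝 (((0 : ℝ), extChartAt (𝓡 m) x₀ x₀), ((0 : ℝ), extChartAt (𝓡 m) x₀ x₀))) :=
      hc.prodMk_nhds (hc.comp hz)
    filter_upwards [h2.eventually h1, hev, hz.eventually hev] with z h3 h4 h5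
    have h6 : ((z.1, extChartAt (𝓡 m) x₀ z.2) - (0, extChartAt (𝓡 m) x₀ z.2) :
        ℝ × EuclideanSpace ℝ (Fin m)) = z.1 • ((1 : ℝ), (0 : EuclideanSpace ℝ (Fin m))) := by
      simp
    have h7 : ‖z.1 • ((1 : ℝ), (0 : EuclideanSpace ℝ (Fin m)))‖ = |z.1| := by
      simp [Prod.norm_def]
    simp only [h6, map_smul, h7, smul_eq_mul, Real.norm_eq_abs] at h3
    rw [h4.2, h5.2]
    exact h3
  refine ⟨D (1, 0), ?_, key⟩
  rw [hasDerivAt_iff_isLittleO, Asymptotics.isLittleO_iff]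
  intro ε hε
  have h1 : Tendsto (fun t : ℝ ↦ (t, x₀)) (𝓝 0) (𝓝 ((0 : ℝ), x₀)) :=
    (continuousAt_id.prodMk continuousAt_const : ContinuousAt (fun t : ℝ ↦ (t, x₀)) 0)
  filter_upwards [h1.eventually (key ε hε)] with t ht
  simpa using ht

end Families

/-! ### Critical points of the `f`-bienergies -/

section Energy

variable {m n : ℕ}
  {M : Type*} [TopologicalSpace M] [T2Space M] [MeasurableSpace M] [BorelSpace M]
  [ChartedSpace (EuclideanSpace ℝ (Fin m)) M]
  [IsManifold (𝓡 m) ∞ M] [RiemannianBundle (fun x : M ↦ TangentSpace (𝓡 m) x)]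
  [IsContMDiffRiemannianBundle (𝓡 m) ∞ (EuclideanSpace ℝ (Fin m))
      (fun x : M ↦ TangentSpace (𝓡 m) x)]
  {N : Type*} [TopologicalSpace N] [ChartedSpace (EuclideanSpace ℝ (Fin n)) N]
  [IsManifold (𝓡 n) ∞ N] [RiemannianBundle (fun y : N ↦ TangentSpace (𝓡 n) y)]
  [IsContMDiffRiemannianBundle (𝓡 n) ∞ (EuclideanSpace ℝ (Fin n))
      (fun y : N ↦ TangentSpace (𝓡 n) y)]

/-- A map with vanishing tension field is a critical point of the `f`-bienergy. -/
theorem isFBiharmonic_of_tension_eq_zero {φ : M → N} (h : ∀ x, tension m n φ x = 0) {f : M → ℝ}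
    (hf : Continuous f) : IsFBiharmonic m n φ f := by
  intro K Φ hK hΦ
  have h0 : ∀ x, tension m n (Φ 0) x = 0 := by rwa [hΦ.zero]
  -- Compactness of `K` turns the local `O(t²)` bounds into a single one.
  have hloc : ∃ C : ℝ, 0 ≤ C ∧ ∀ᶠ t in 𝓝 (0 : ℝ), ∀ x ∈ K,
      ‖tension m n (Φ t) x‖ ^ 2 ≤ C * t ^ 2 := by
    refine hK.induction_on
      (p := fun s ↦ ∃ C : ℝ, 0 ≤ C ∧ ∀ᶠ t in 𝓝 (0 : ℝ), ∀ x ∈ s,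
        ‖tension m n (Φ t) x‖ ^ 2 ≤ C * t ^ 2) ⟨0, le_rfl, by simp⟩ ?_ ?_ ?_
    · rintro s t hst ⟨C, hC0, hC⟩
      exact ⟨C, hC0, hC.mono fun t ht x hx ↦ ht x (hst hx)⟩
    · rintro s t ⟨C, hC0, hC⟩ ⟨C', hC0', hC'⟩
      refine ⟨max C C', hC0.trans (le_max_left _ _), ?_⟩
      filter_upwards [hC, hC'] with r hr hr' x hx
      rcases hx with hx | hx
      · exact (hr x hx).trans (by gcongr; exact le_max_left _ _)
      · exact (hr' x hx).trans (by gcongr; exact le_max_right _ _)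
    · intro x _
      obtain ⟨C, hC⟩ := eventually_normSq_tension_le hΦ.smooth h0 x
      rw [nhds_prod_eq] at hC
      obtain ⟨p, hp, s, hs, hps⟩ := eventually_prod_iff.mp hC
      refine ⟨{x | s x}, mem_nhdsWithin_of_mem_nhds hs, max C 0, le_max_right _ _, ?_⟩
      filter_upwards [hp] with t ht x hx
      exact (hps ht hx).trans (by gcongr; exact le_max_left _ _)
  obtain ⟨C, hC0, hC⟩ := hloc
  obtain ⟨A, hA⟩ := hK.exists_bound_of_continuousOn hf.continuousOn
  have hO : (fun t ↦ fBienergy m n f K (Φ t)) =O[𝓝 0] fun t ↦ ‖t - 0‖ ^ 2 := by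
    refine Asymptotics.IsBigO.of_bound
      ((1 / 2) * (|A| * C * (riemannianVolume m M).real K)) ?_
    filter_upwards [hC] with t ht
    have h1 := norm_setIntegral_le_of_norm_le_const (μ := riemannianVolume m M)
      (f := fun x ↦ f x * ‖tension m n (Φ t) x‖ ^ 2) (C := |A| * (C * t ^ 2))
      (riemannianVolume_lt_top hK) fun x hx ↦ by
        rw [norm_mul]
        refine mul_le_mul ((hA x hx).trans (le_abs_self _)) ?_ (norm_nonneg _) (abs_nonneg _)
        rw [Real.norm_of_nonneg (by positivity)]
        exact ht x hx
    rw [fBienergy, norm_mul]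
    calc _ ≤ ‖(1 / 2 : ℝ)‖ * (|A| * (C * t ^ 2) * (riemannianVolume m M).real K) := by gcongr
      _ = _ := by
        rw [Real.norm_of_nonneg (by norm_num), norm_pow, norm_norm, sub_zero, Real.norm_eq_abs,
          sq_abs]
        ring
  -- A function that is `O(|t|²)` at `0` has derivative zero there, since the exponent exceeds one.
  have h2 := hO.hasFDerivAt (𝕜 := ℝ) one_lt_two
  simpa using h2.hasDerivAt

variable [SecondCountableTopology M]

/-- At a critical point of all the `f`-bienergies, the squared norm of the tension field is
pointwise stationary. -/
theorem derivative_normSq_tension_nonpos {φ : M → N}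
    (h : ∀ f : M → ℝ, ContMDiff (𝓡 m) 𝓘(ℝ, ℝ) ∞ f → (∀ x, 0 < f x) → IsFBiharmonic m n φ f)
    {K : Set M} (hK : IsCompact K) {Φ : ℝ → M → N} (hΦ : IsVariation m n φ K Φ) {x₀ : M}
    (hx₀ : K ∈ 𝓝 x₀) {a : ℝ} (ha : HasDerivAt (fun t ↦ ‖tension m n (Φ t) x₀‖ ^ 2) a 0) :
    a ≤ 0 := by
  by_contra! hapos
  obtain ⟨a', ha', hstrict⟩ := exists_strict_derivative_normSq_tension hΦ.smooth x₀
  obtain rfl := ha.unique ha'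
  set μ := riemannianVolume m M
  have hμ : IsFiniteMeasureOnCompacts μ := ⟨fun _ hK ↦ riemannianVolume_lt_top hK⟩
  -- With error at most `(a / 2)|t|`, the difference quotients for small `t > 0` are at least `a /
  -- 2` on a whole neighbourhood of `x₀`, in which the support of `χ` is then placed.
  have hev := hstrict (a / 2) (half_pos hapos)
  rw [nhds_prod_eq] at hev
  obtain ⟨p, hp, s, hs, hps⟩ := eventually_prod_iff.mp hev
  obtain ⟨χ, -, hχ⟩ := (SmoothBumpFunction.nhds_basis_tsupport (I := 𝓡 m) x₀).mem_iff.mp hs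
  obtain ⟨F, hF⟩ : ∃ F : ℝ → M → ℝ, ∀ t x, ‖tension m n (Φ t) x‖ ^ 2 = F t x := ⟨_, fun _ _ ↦ rfl⟩
  have hFc : ∀ t, Continuous (F t) := by
    have h0 := continuous_normSq_tension hΦ.smooth
    simp only [hF] at h0
    exact fun t ↦ h0.comp (continuous_const.prodMk continuous_id)
  simp only [hF] at hps
  have hint : ∀ g : M → ℝ, Continuous g → ∀ t, IntegrableOn (fun x ↦ g x * F t x) K μ :=
    fun g hg t ↦ (hg.mul (hFc t)).continuousOn.integrableOn_compact hK
  have hχc : Continuous χ := χ.continuous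
  have hχi : IntegrableOn χ K μ := hχc.continuousOn.integrableOn_compact hK
  have h1 := h (fun _ ↦ 1) contMDiff_const (fun _ ↦ one_pos) K Φ hK hΦ
  have h2 := h (fun x ↦ 1 + χ x) (contMDiff_const.add χ.contMDiff)
    (fun x ↦ add_pos_of_pos_of_nonneg one_pos χ.nonneg) K Φ hK hΦ
  -- The bump `χ` is not an admissible weight, as it is not positive everywhere. It is the
  -- difference of the admissible weights `1 + χ` and `1`, and the energy is linear in the weight.
  have h3 : HasDerivAt (fun t ↦ ∫ x in K, χ x * F t x ∂μ) 0 0 := by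
    have h4 := (h2.sub h1).const_mul 2
    simp only [sub_zero, mul_zero] at h4
    refine h4.congr_of_eventuallyEq (Eventually.of_forall fun t ↦ ?_)
    simp only [fBienergy, Pi.sub_apply, hF]
    have h5 : ∫ x in K, (1 + χ x) * F t x ∂μ
        = ∫ x in K, 1 * F t x ∂μ + ∫ x in K, χ x * F t x ∂μ := by
      rw [← integral_add (hint (fun _ ↦ 1) continuous_const t) (hint χ hχc t)]
      refine integral_congr_ae (Eventually.of_forall fun x ↦ ?_)
      simp only [add_mul]
    rw [h5]
    ring
  have hc : 0 < ∫ x in K, χ x ∂μ := by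
    rw [setIntegral_pos_iff_support_of_nonneg_ae (Eventually.of_forall fun x ↦ χ.nonneg) hχi]
    obtain ⟨W, hW, hWo, hxW⟩ := mem_nhds_iff.mp (inter_mem χ.eventuallyEq_one hx₀)
    refine (riemannianVolume_pos hWo ⟨x₀, hxW⟩).trans_le (measure_mono fun x hx ↦ ⟨?_, (hW hx).2⟩)
    have h6 : χ x = 1 := (hW hx).1
    rw [Function.mem_support, h6]
    exact one_ne_zero
  have h7 := h3.tendsto_slope_zero_right
  -- The right difference quotients are bounded below by the positive number `(a / 2) ∫ χ`, although
  -- they tend to zero.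
  have h8 : ∀ᶠ t in 𝓝[>] (0 : ℝ), a / 2 * ∫ x in K, χ x ∂μ
      ≤ t⁻¹ • ((∫ x in K, χ x * F (0 + t) x ∂μ) - ∫ x in K, χ x * F 0 x ∂μ) := by
    filter_upwards [self_mem_nhdsWithin, mem_nhdsWithin_of_mem_nhds hp] with t ht hpt
    rw [mem_Ioi] at ht
    rw [zero_add, ← integral_sub (hint χ hχc t) (hint χ hχc 0), smul_eq_mul,
      ← integral_const_mul, ← integral_const_mul]
    refine integral_mono (hχi.const_mul _)
      (((hint χ hχc t).sub (hint χ hχc 0)).const_mul _) fun x ↦ ?_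
    simp only []
    by_cases hx : x ∈ tsupport χ
    · have h9 := (abs_le.mp (hps hpt (hχ hx))).1
      simp only [abs_of_pos ht] at h9
      have h10 : a / 2 ≤ t⁻¹ * (F t x - F 0 x) := by
        rw [le_inv_mul_iff₀ ht]
        linarith only [h9]
      calc a / 2 * χ x ≤ t⁻¹ * (F t x - F 0 x) * χ x :=
            mul_le_mul_of_nonneg_right h10 χ.nonneg
        _ = _ := by ring
    · simp [image_eq_zero_of_notMem_tsupport hx]
  have h11 := ge_of_tendsto h7 h8
  exact absurd h11 (not_le.mpr (mul_pos (half_pos hapos) hc))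

end Energy

/-! ### Quadratic variations, and the converse for critical points -/

section Coordinates

variable {k : ℕ} {F : Type*} [NormedAddCommGroup F] [NormedSpace ℝ F]

/-- The effect on the covariant Hessian of adding a quadratic term. -/
theorem hess_add_quadratic {E : Type*} [NormedAddCommGroup E] [InnerProductSpace ℝ E]
    {G : E → E →L[ℝ] E →L[ℝ] ℝ} {H : F → F →L[ℝ] F →L[ℝ] ℝ} {ψ : E → F} {p : E}
    (hψ : ContDiffAt ℝ ∞ ψ p) (σ : ℝ) (v : F) (u w : E) :
    hess G H (fun q ↦ ψ q + (σ * ‖q - p‖ ^ 2) • v) p u w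
      = hess G H ψ p u w + (σ * (2 * inner ℝ u w)) • v := by
  have hq : ∀ r, HasFDerivAt (fun q ↦ (σ * ‖q - p‖ ^ 2) • v)
      ((σ • (2 : ℝ) • innerSL ℝ (r - p)).smulRight v) r := fun r ↦
    ((hasFDerivAt_norm_sub_sq p r).const_mul σ).smul_const v
  have hd : ∀ᶠ r in 𝓝 p, DifferentiableAt ℝ ψ r := by
    filter_upwards [(hψ.of_le (m := 1) (by simp)).eventually (by simp)] with r hr
      using hr.differentiableAt (by simp)
  have h1 : fderiv ℝ (fun q ↦ ψ q + (σ * ‖q - p‖ ^ 2) • v) =ᶠ[𝓝 p]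
      fun r ↦ fderiv ℝ ψ r + (σ • (2 : ℝ) • innerSL ℝ (r - p)).smulRight v := by
    filter_upwards [hd] with r hr
    exact (hr.hasFDerivAt.add (hq r)).fderiv
  -- The added term vanishes to first order at `p`, so both Christoffel terms of the Hessian are
  -- unchanged and only the second derivative moves.
  have h2 : fderiv ℝ (fun q ↦ ψ q + (σ * ‖q - p‖ ^ 2) • v) p = fderiv ℝ ψ p := by
    refine h1.self_of_nhds.trans ?_
    ext
    simp
  let I : E →L[ℝ] E →L[ℝ] ℝ := innerSL ℝ
  let S : (E →L[ℝ] ℝ) →L[ℝ] E →L[ℝ] F :=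
    (ContinuousLinearMap.smulRightL ℝ E F).flip v
  have h3 : HasFDerivAt (fun r : E ↦ (σ • (2 : ℝ) • innerSL ℝ (r - p)).smulRight v)
      (S.comp (σ • (2 : ℝ) • I)) p := by
    have h4 : HasFDerivAt (fun r : E ↦ σ • (2 : ℝ) • innerSL ℝ (r - p))
        (σ • (2 : ℝ) • I) p := by
      have h5 : HasFDerivAt (fun p' : E ↦ innerSL ℝ (p' - p)) I p :=
        I.hasFDerivAt.comp p ((hasFDerivAt_id p).sub_const p)
      exact (h5.const_smul (2 : ℝ)).const_smul σ
    exact S.hasFDerivAt.comp p h4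
  have hdd : DifferentiableAt ℝ (fderiv ℝ ψ) p :=
    (hψ.fderiv_right (m := ∞) (by simp)).differentiableAt (by simp)
  have h6 : fderiv ℝ (fderiv ℝ (fun q ↦ ψ q + (σ * ‖q - p‖ ^ 2) • v)) p
      = fderiv ℝ (fderiv ℝ ψ) p + S.comp (σ • (2 : ℝ) • I) :=
    h1.fderiv_eq.trans (hdd.hasFDerivAt.add h3).fderiv
  rw [hess_apply, hess_apply, h2, h6]
  simp only [sub_self, norm_zero, ne_eq, OfNat.ofNat_ne_zero, not_false_eq_true, zero_pow,
    mul_zero, zero_smul, add_zero, _root_.add_apply]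
  have h7 : S.comp (σ • (2 : ℝ) • I) u w = (σ * (2 * inner ℝ u w)) • v := by
    have h8 : I u w = inner ℝ u w := rfl
    simp only [S, ContinuousLinearMap.comp_apply, ContinuousLinearMap.flip_apply]
    change ((σ • (2 : ℝ) • I) u w) • v = _
    simp only [_root_.smul_apply, h8, smul_eq_mul]
  rw [h7]
  abel

end Coordinates

section Variation

variable {m n : ℕ}
  {M : Type*} [TopologicalSpace M] [T2Space M] [ChartedSpace (EuclideanSpace ℝ (Fin m)) M]
  [IsManifold (𝓡 m) ∞ M]
  {N : Type*} [TopologicalSpace N] [ChartedSpace (EuclideanSpace ℝ (Fin n)) N]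
  [IsManifold (𝓡 n) ∞ N]

/-- A compactly supported variation which, in coordinates near `x₀`, moves the map in a constant
direction by a multiple of the square of the distance to `x₀`. -/
theorem exists_quadratic_variation {φ : M → N} (hφ : ContMDiff (𝓡 m) (𝓡 n) ∞ φ) (x₀ : M)
    (v : EuclideanSpace ℝ (Fin n)) :
    ∃ (K : Set M) (Φ : ℝ → M → N) (δ : ℝ), IsCompact K ∧ K ∈ 𝓝 x₀ ∧ IsVariation m n φ K Φ ∧
      0 < δ ∧ ∀ t, coordMap m n (Φ t) x₀ (φ x₀) =ᶠ[𝓝 (extChartAt (𝓡 m) x₀ x₀)]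
        fun p ↦ coordMap m n φ x₀ (φ x₀) p
          + ((δ * Real.sin t) * ‖p - extChartAt (𝓡 m) x₀ x₀‖ ^ 2) • v := by
  classical
  set c := extChartAt (𝓡 n) (φ x₀) with hc
  set U : Set M := φ ⁻¹' c.source with hU
  have hUo : IsOpen U := (isOpen_extChartAt_source (φ x₀)).preimage hφ.continuous
  have hxU : U ∈ 𝓝 x₀ := hUo.mem_nhds (mem_extChartAt_source (φ x₀))
  obtain ⟨q, K, hq, -, hK, hKU, hKx, hqK, hquad⟩ := exists_quadratic_bump (m := m) hxU
  have hcφ : ContinuousOn (c ∘ φ) U :=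
    (continuousOn_extChartAt (φ x₀)).comp hφ.continuous.continuousOn fun x hx ↦ hx
  obtain ⟨ε, hε, hεt⟩ := (hK.image_of_continuousOn (hcφ.mono hKU)).exists_cthickening_subset_open
    (isOpen_extChartAt_target (I := 𝓡 n) (φ x₀)) (by
      rintro _ ⟨x, hx, rfl⟩
      exact c.map_source (hKU hx))
  obtain ⟨B, hB⟩ := hK.exists_bound_of_continuousOn hq.continuous.continuousOn
  -- On `K` the displacement is at most `δ|B|‖v‖ ≤ ε`, which keeps the moved point in the chart
  -- target; the `+ 1` keeps the denominator positive.
  set δ := ε / (|B| * ‖v‖ + 1) with hδ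
  have hδ0 : 0 < δ := by positivity
  -- A variation must be defined for every real `t`. The bounded function `sin t` replaces `t`, with
  -- the same derivative at `0`.
  let A : ℝ → M → EuclideanSpace ℝ (Fin n) := fun t x ↦ c (φ x) + ((δ * Real.sin t) * q x) • v
  have hA0 : ∀ t, ∀ x ∉ K, A t x = c (φ x) := fun t x hx ↦ by simp [A, hqK x hx]
  have hAt : ∀ t, ∀ x ∈ U, A t x ∈ c.target := by
    intro t x hx
    by_cases hxK : x ∈ K
    · refine hεt (Metric.mem_cthickening_of_dist_le _ (c (φ x)) _ _ ⟨x, hxK, rfl⟩ ?_)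
      rw [dist_eq_norm]
      simp only [A, add_sub_cancel_left, norm_smul, norm_mul, Real.norm_eq_abs, abs_of_pos hδ0]
      have hqB : |q x| ≤ |B| := (hB x hxK).trans (le_abs_self B)
      have hsin := Real.abs_sin_le_one t
      calc δ * |Real.sin t| * |q x| * ‖v‖ ≤ δ * 1 * |B| * ‖v‖ := by
            exact mul_le_mul_of_nonneg_right
              (mul_le_mul (by gcongr) hqB (abs_nonneg _) (by positivity)) (norm_nonneg v)
        _ ≤ δ * (|B| * ‖v‖ + 1) := by nlinarith
        _ = ε := by rw [hδ]; field_simp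
    · rw [hA0 t x hxK]
      exact c.map_source hx
  -- The two branches agree on `U \ K`. Since `U` and the complement of `K` are open and cover `M`,
  -- smoothness can be checked on each with a single formula.
  let Φ : ℝ → M → N := fun t x ↦ if x ∈ K then c.symm (A t x) else φ x
  have hΦU : ∀ t, ∀ x ∈ U, Φ t x = c.symm (A t x) := by
    intro t x hx
    by_cases hxK : x ∈ K
    · simp only [Φ, hxK, if_true]
    · simp only [Φ, hxK, if_false, hA0 t x hxK]
      exact (c.left_inv hx).symm
  have hΦK : ∀ t, ∀ x ∉ K, Φ t x = φ x := fun t x hx ↦ by simp only [Φ, hx, if_false]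
  refine ⟨K, Φ, δ, hK, hKx, ⟨?_, ?_, hΦK⟩, hδ0, fun t ↦ ?_⟩
  · rintro ⟨t, x⟩
    by_cases hx : x ∈ U
    · have hev : (fun p : ℝ × M ↦ Φ p.1 p.2) =ᶠ[𝓝 (t, x)] fun p ↦ c.symm (A p.1 p.2) := by
        filter_upwards [continuous_snd.continuousAt.eventually (hUo.mem_nhds hx)] with p hp
          using hΦU p.1 p.2 hp
      refine ContMDiffAt.congr_of_eventuallyEq ?_ hev
      have hAs : ContMDiffAt (𝓘(ℝ, ℝ).prod (𝓡 m)) 𝓘(ℝ, EuclideanSpace ℝ (Fin n)) ∞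
          (fun p : ℝ × M ↦ A p.1 p.2) (t, x) := by
        have a1 : ContMDiffAt (𝓘(ℝ, ℝ).prod (𝓡 m)) (𝓡 n) ∞ (fun p : ℝ × M ↦ φ p.2) (t, x) :=
          hφ.contMDiffAt.comp (t, x) contMDiffAt_snd
        have a2 : ContMDiffAt (𝓡 n) 𝓘(ℝ, EuclideanSpace ℝ (Fin n)) ∞ c (φ x) :=
          contMDiffAt_extChartAt' (by rw [hU, hc] at hx; simpa using hx)
        have a3 : ContMDiffAt (𝓘(ℝ, ℝ).prod (𝓡 m)) 𝓘(ℝ, EuclideanSpace ℝ (Fin n)) ∞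
            (fun p : ℝ × M ↦ c (φ p.2)) (t, x) :=
          ContMDiffAt.comp (I' := 𝓡 n) (g := c) (t, x) a2 a1
        have a4 : ContMDiffAt (𝓘(ℝ, ℝ).prod (𝓡 m)) 𝓘(ℝ, ℝ) ∞
            (fun p : ℝ × M ↦ δ * Real.sin p.1) (t, x) :=
          ContMDiffAt.comp (I' := 𝓘(ℝ, ℝ)) (g := fun s : ℝ ↦ δ * Real.sin s) (t, x)
            (contDiff_const.mul Real.contDiff_sin).contMDiff.contMDiffAt contMDiffAt_fst
        have a5 : ContMDiffAt (𝓘(ℝ, ℝ).prod (𝓡 m)) 𝓘(ℝ, ℝ) ∞ (fun p : ℝ × M ↦ q p.2) (t, x) :=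
          hq.contMDiffAt.comp (t, x) contMDiffAt_snd
        exact a3.add ((a4.mul a5).smul contMDiffAt_const)
      have hs : ContMDiffAt 𝓘(ℝ, EuclideanSpace ℝ (Fin n)) (𝓡 n) ∞ c.symm (A t x) :=
        (contMDiffOn_extChartAt_symm (φ x₀)).contMDiffAt
          ((isOpen_extChartAt_target (φ x₀)).mem_nhds (hAt t x hx))
      exact ContMDiffAt.comp (I' := 𝓘(ℝ, EuclideanSpace ℝ (Fin n))) (g := c.symm) (t, x) hs hAs
    · have hxK : Kᶜ ∈ 𝓝 x := hK.isClosed.isOpen_compl.mem_nhds fun h ↦ hx (hKU h)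
      refine ContMDiffAt.congr_of_eventuallyEq
        (ContMDiffAt.comp (t, x) hφ.contMDiffAt contMDiffAt_snd) ?_
      filter_upwards [continuous_snd.continuousAt.eventually hxK] with p hp using hΦK p.1 p.2 hp
  · ext x
    by_cases hxK : x ∈ K
    · rw [hΦU 0 x (hKU hxK)]
      simp only [A, Real.sin_zero, mul_zero, zero_mul, zero_smul, add_zero]
      exact c.left_inv (hKU hxK)
    · exact hΦK 0 x hxK
  · have hcs := continuousAt_extChartAt_symm (I := 𝓡 m) x₀
    rw [ContinuousAt, extChartAt_to_inv] at hcs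
    filter_upwards [hcs.eventually hxU, hquad] with p hp hqp
    rw [Function.comp_apply] at hqp
    simp only [coordMap, Function.comp_apply]
    rw [hΦU t _ hp, ← hc, c.right_inv (hAt t _ hp)]
    simp only [A, hqp]

variable [RiemannianBundle (fun x : M ↦ TangentSpace (𝓡 m) x)]
  [IsContMDiffRiemannianBundle (𝓡 m) ∞ (EuclideanSpace ℝ (Fin m))
      (fun x : M ↦ TangentSpace (𝓡 m) x)]
  [RiemannianBundle (fun y : N ↦ TangentSpace (𝓡 n) y)]
  [IsContMDiffRiemannianBundle (𝓡 n) ∞ (EuclideanSpace ℝ (Fin n))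
      (fun y : N ↦ TangentSpace (𝓡 n) y)]

omit [T2Space M] in
/-- The tension field at `x₀` of a map obtained by adding a quadratic term. -/
theorem normSq_tension_quadratic {φ ψ : M → N} (hφ : ContMDiff (𝓡 m) (𝓡 n) ∞ φ)
    (hψ : ContMDiff (𝓡 m) (𝓡 n) ∞ ψ) {x₀ : M} {σ : ℝ}
    (h : coordMap m n ψ x₀ (φ x₀) =ᶠ[𝓝 (extChartAt (𝓡 m) x₀ x₀)]
      fun p ↦ coordMap m n φ x₀ (φ x₀) p
        + (σ * ‖p - extChartAt (𝓡 m) x₀ x₀‖ ^ 2) • coframe (φ x₀) (φ x₀) (tension m n φ x₀))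
    (hψx : ψ x₀ = φ x₀) :
    ‖tension m n ψ x₀‖ ^ 2
      = (1 + σ * ∑ i, 2 * ‖coframe x₀ x₀ (onb m x₀ i)‖ ^ 2) ^ 2 * ‖tension m n φ x₀‖ ^ 2 := by
  have hx := mem_extChartAt_source (I := 𝓡 m) x₀
  have hy := mem_extChartAt_source (I := 𝓡 n) (φ x₀)
  have hy' : ψ x₀ ∈ (extChartAt (𝓡 n) (φ x₀)).source := by rw [hψx]; exact hy
  have horth : ∀ i j, metricCoord x₀ (extChartAt (𝓡 m) x₀ x₀) (coframe x₀ x₀ (onb m x₀ i))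
      (coframe x₀ x₀ (onb m x₀ j)) = if i = j then 1 else 0 := by
    intro i j
    rw [metricCoord_coframe hx]
    exact orthonormal_iff_ite.mp (onb m x₀).orthonormal i j
  have hinv := metricCoord_isInvertible (n := m) (mem_extChartAt_target x₀)
  have h1 := coframe_tension hψ hx hy'
  have h2 := coframe_tension hφ hx hy
  -- The Hessian gains `2σ⟨u, w⟩` times the components of `τ(x₀)`, so its trace gains a multiple of
  -- `τ(x₀)` itself.
  have h3 : coframe (φ x₀) (ψ x₀) (tension m n ψ x₀)
      = (1 + σ * ∑ i, 2 * ‖coframe x₀ x₀ (onb m x₀ i)‖ ^ 2) •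
        coframe (φ x₀) (φ x₀) (tension m n φ x₀) := by
    rw [h1, hessCoord, hess_congr h, traceForm_eq_sum hinv _ horth]
    simp only [hess_add_quadratic (contDiffAt_coordMap hφ.contMDiffAt hx hy)]
    rw [Finset.sum_add_distrib, add_smul, one_smul, Finset.mul_sum, Finset.sum_smul]
    congr 1
    · rw [h2, hessCoord, traceForm_eq_sum hinv _ horth]
    · simp only [real_inner_self_eq_norm_sq]
  rw [← real_inner_self_eq_norm_sq, ← metricCoord_coframe hy', h3, hψx]
  simp only [map_smul, _root_.smul_apply, smul_eq_mul]
  rw [metricCoord_coframe hy, real_inner_self_eq_norm_sq]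
  ring

variable [MeasurableSpace M] [BorelSpace M] [SecondCountableTopology M]

/-- If a map is a critical point of all the `f`-bienergies, then its tension field vanishes. -/
theorem tension_eq_zero_of_isFBiharmonic {φ : M → N} (hφ : ContMDiff (𝓡 m) (𝓡 n) ∞ φ)
    (h : ∀ f : M → ℝ, ContMDiff (𝓡 m) 𝓘(ℝ, ℝ) ∞ f → (∀ x, 0 < f x) → IsFBiharmonic m n φ f)
    (x₀ : M) : tension m n φ x₀ = 0 := by
  rcases eq_or_ne m 0 with rfl | hm
  · simp [tension]
  by_contra hτ
  obtain ⟨K, Φ, δ, hK, hKx, hΦ, hδ, hcoord⟩ := exists_quadratic_variation hφ x₀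
    (coframe (φ x₀) (φ x₀) (tension m n φ x₀))
  have hL := sum_norm_coframe_pos hm x₀
  set L := ∑ i, 2 * ‖coframe x₀ x₀ (onb m x₀ i)‖ ^ 2
  have hx := mem_extChartAt_source (I := 𝓡 m) x₀
  have hsmooth := contMDiff_slice hΦ.smooth
  -- The quadratic term is zero at `x₀`, so the coordinates of `Φ t x₀` and `φ x₀` agree. The chart
  -- is injective only on its source, where `Φ t x₀` is known to lie for small `t`.
  have hΦx : ∀ᶠ t in 𝓝 (0 : ℝ), Φ t x₀ = φ x₀ := by
    have hcont : Continuous fun t ↦ Φ t x₀ :=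
      hΦ.smooth.continuous.comp (continuous_id.prodMk continuous_const)
    have hs : (extChartAt (𝓡 n) (φ x₀)).source ∈ 𝓝 (Φ 0 x₀) := by
      rw [hΦ.zero]
      exact extChartAt_source_mem_nhds (φ x₀)
    filter_upwards [hcont.continuousAt.eventually hs] with t ht
    have h1 := (hcoord t).self_of_nhds
    simp only [coordMap_extChartAt _ _ hx] at h1
    refine (extChartAt (𝓡 n) (φ x₀)).injOn ht (mem_extChartAt_source (φ x₀)) ?_
    simpa using h1
  have hF : (fun t ↦ ‖tension m n (Φ t) x₀‖ ^ 2) =ᶠ[𝓝 0]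
      fun t ↦ (1 + δ * Real.sin t * L) ^ 2 * ‖tension m n φ x₀‖ ^ 2 := by
    filter_upwards [hΦx] with t ht
    exact normSq_tension_quadratic hφ (hsmooth t) (hcoord t) ht
  have hd : HasDerivAt (fun t ↦ (1 + δ * Real.sin t * L) ^ 2 * ‖tension m n φ x₀‖ ^ 2)
      (2 * δ * L * ‖tension m n φ x₀‖ ^ 2) 0 := by
    have h1 := ((((((Real.hasDerivAt_sin 0).const_mul δ).mul_const L).const_add 1).pow
      2).mul_const (‖tension m n φ x₀‖ ^ 2))
    exact h1.congr_deriv (by simp only [Real.sin_zero, Real.cos_zero]; push_cast; ring)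
  have := derivative_normSq_tension_nonpos h hK hΦ hKx (hd.congr_of_eventuallyEq hF)
  have hpos : 0 < ‖tension m n φ x₀‖ := norm_pos_iff.mpr hτ
  exact absurd this (not_le.mpr (by positivity))

end Variation

end FBiharm

end

/-- An isometrically immersed submanifold `φ : M^m → (N^n, h)` is minimal if and only if it is
`f`-biharmonic for every positive smooth function `f`; this is stated both with `f`-biharmonicity as
criticality for the `f`-bienergy and with the `f`-biharmonic map equation `τ_{2,f}(φ) = 0`. -/
theorem corollary2p3 {m n : ℕ}
    {M : Type*} [TopologicalSpace M] [T2Space M] [SecondCountableTopology M]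
    [MeasurableSpace M] [BorelSpace M]
    [ChartedSpace (EuclideanSpace ℝ (Fin m)) M] [IsManifold (𝓡 m) ∞ M]
    [RiemannianBundle (fun x : M ↦ TangentSpace (𝓡 m) x)]
    [IsContMDiffRiemannianBundle (𝓡 m) ∞ (EuclideanSpace ℝ (Fin m))
      (fun x : M ↦ TangentSpace (𝓡 m) x)]
    {N : Type*} [TopologicalSpace N] [T2Space N] [SecondCountableTopology N]
    [ChartedSpace (EuclideanSpace ℝ (Fin n)) N] [IsManifold (𝓡 n) ∞ N]
    [RiemannianBundle (fun y : N ↦ TangentSpace (𝓡 n) y)]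
    [IsContMDiffRiemannianBundle (𝓡 n) ∞ (EuclideanSpace ℝ (Fin n))
      (fun y : N ↦ TangentSpace (𝓡 n) y)]
    (φ : M → N) (hφ : FBiharm.IsIsometricImmersion m n φ) :
    (FBiharm.IsMinimal m n φ ↔
      ∀ f : M → ℝ, ContMDiff (𝓡 m) 𝓘(ℝ, ℝ) ∞ f → (∀ x, 0 < f x) → FBiharm.IsFBiharmonic m n φ f) ∧
    (FBiharm.IsMinimal m n φ ↔
      ∀ f : M → ℝ, ContMDiff (𝓡 m) 𝓘(ℝ, ℝ) ∞ f → (∀ x, 0 < f x) →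
        ∀ x, FBiharm.fBitension m n φ f x = 0) := by
  have hmin := FBiharm.isMinimal_iff_tension hφ
  exact ⟨⟨fun h f hf _ ↦ FBiharm.isFBiharmonic_of_tension_eq_zero (hmin.mp h) hf.continuous,
      fun h ↦ hmin.mpr (FBiharm.tension_eq_zero_of_isFBiharmonic hφ.smooth h)⟩,
    ⟨fun h f _ _ x ↦ FBiharm.fBitension_eq_zero hφ.smooth (hmin.mp h) f x,
      fun h ↦ hmin.mpr (FBiharm.tension_eq_zero_of_fBitension h)⟩⟩
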